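/- Let $G$ be a locally compact (Hausdorff) group with a fixed left Haar measure, $L_1(G)$ its group algebra with convolution $(f*g)(t)=\int_G f(y)\,g(y^{-1}t)\,dy$, and $L_\infty(G)=L_1(G)^*$. Let $\mathrm{LUC}(G)$ be the space, with the supremum norm, of all bounded functions $f:G\to\mathbb{C}$ for which $x\mapsto l_xf$, $(l_xf)(y)=f(xy)$, is continuous into the bounded functions with the supremum norm. The dual $\mathrm{LUC}(G)^*$ carries the product $\langle m\cdot n,f\rangle=\langle m,n\cdot f\rangle$, where $(n\cdot f)(x)=\langle n,l_xf\rangle$; its identity is $\delta_e: f\mapsto f(e)$. For $h\in L_\infty(G)$ and $g\in L_1(G)$ let $h\odot g\in\mathrm{LUC}(G)$ be the function $(h\odot g)(x)=\langle h,g*\delta_x\rangle$, which represents the functional $k\mapsto\langle h,g*k\rangle$ on $L_1(G)$, and for $m\in\mathrm{LUC}(G)^*$ let $m\Diamond h\in L_\infty(G)$ be given by $\langle m\Diamond h,g\rangle=\langle m,h\odot g\rangle$. Let $M(G)$ be the set of regular complex Borel measures on $G$, regarded as a subset of $\mathrm{LUC}(G)^*$ through $\langle\nu,f\rangle=\int_G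 f\,d\nu$, and let $\mathcal B^\sigma(L_\infty(G))$ be the set of bounded operators on $L_\infty(G)$ that are normal, that is, $w^*$-$w^*$-continuous for the topology $\sigma(L_\infty(G),L_1(G))$. Then the map $\phi:\mathrm{LUC}(G)^*\to\mathcal B(L_\infty(G))$, $\phi(m)(h)=m\Diamond h$, is an isometric representation: it is linear, $\phi(m\cdot n)=\phi(m)\phi(n)$ and $\|\phi(m)\|=\|m\|$ for all $m,n\in\mathrm{LUC}(G)^*$, and $\phi(\delta_e)=\mathrm{id}$. Moreover, $$\phi(M(G))=\phi(\mathrm{LUC}(G)^*)\cap\mathcal B^\sigma(L_\infty(G)).$$ -/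

import Mathlib

open MeasureTheory MeasureTheory.Measure Topology Filter
open scoped BoundedContinuousFunction ENNReal NNReal

noncomputable section

namespace LUCDual

section LUC

variable (G : Type*) [Group G] [TopologicalSpace G]

/-- `LUC(G)`: the bounded complex-valued functions `f` on `G` that are left uniformly continuous,
i.e. `x ↦ l_x f`, `(l_x f)(y) = f (x y)`, is continuous for the supremum norm. (Continuity at the
neutral element is enough.) It carries the supremum norm. -/
def LUC : Submodule ℂ (G →ᵇ ℂ) where
  carrier := {f | ∀ ε > 0, ∀ᶠ x in 𝓝 (1 : G), ∀ y, ‖f (x * y) - f y‖ ≤ ε}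
  zero_mem' := fun ε hε => Eventually.of_forall fun x y => by simpa using hε.le
  add_mem' := by
    intro f g hf hg ε hε
    filter_upwards [hf (ε / 2) (half_pos hε), hg (ε / 2) (half_pos hε)] with x h1 h2 y
    have : (f + g) (x * y) - (f + g) y = (f (x * y) - f y) + (g (x * y) - g y) := by
      simp only [BoundedContinuousFunction.coe_add, Pi.add_apply]; ring
    rw [this]
    exact (norm_add_le _ _).trans (by linarith [h1 y, h2 y])
  smul_mem' := by
    intro c f hf ε hε
    filter_upwards [hf (ε / (‖c‖ + 1)) (by positivity)] with x h1 y
    have : (c • f) (x * y) - (c • f) y = c * (f (x * y) - f y) := by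
      simp only [BoundedContinuousFunction.coe_smul, smul_eq_mul]; ring
    rw [this, norm_mul]
    calc ‖c‖ * ‖f (x * y) - f y‖ ≤ ‖c‖ * (ε / (‖c‖ + 1)) := by gcongr; exact h1 y
      _ ≤ (‖c‖ + 1) * (ε / (‖c‖ + 1)) := by gcongr; linarith
      _ = ε := by field_simp

variable {G}

instance : CoeFun (LUC G) (fun _ => G → ℂ) := ⟨fun f => (f : G →ᵇ ℂ)⟩

theorem LUC.ext {f g : LUC G} (h : ∀ x, f x = g x) : f = g :=
  Subtype.ext (BoundedContinuousFunction.ext h)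

theorem LUC.norm_apply_le (f : LUC G) (x : G) : ‖f x‖ ≤ ‖f‖ :=
  (f : G →ᵇ ℂ).norm_coe_le_norm x

theorem LUC.norm_le {f : LUC G} {C : ℝ} (hC : 0 ≤ C) (h : ∀ x, ‖f x‖ ≤ C) : ‖f‖ ≤ C :=
  (BoundedContinuousFunction.norm_le hC).2 h

/-- The identity of `LUC(G)^*`: the evaluation at the neutral element. -/
def lucOne : StrongDual ℂ (LUC G) :=
  (BoundedContinuousFunction.evalCLM ℂ (1 : G)).comp (LUC G).subtypeL

@[simp] theorem lucOne_apply (f : LUC G) : lucOne f = f 1 := rfl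

variable [IsTopologicalGroup G]

theorem continuous_of_left_uniform {f : G → ℂ}
    (hf : ∀ ε > 0, ∀ᶠ x in 𝓝 (1 : G), ∀ y, ‖f (x * y) - f y‖ ≤ ε) : Continuous f := by
  rw [continuous_iff_continuousAt]
  intro y
  rw [ContinuousAt, Metric.tendsto_nhds]
  intro ε hε
  have h : Tendsto (fun z => z * y⁻¹) (𝓝 y) (𝓝 1) := by
    have : Continuous fun z : G => z * y⁻¹ := by fun_prop
    simpa using this.tendsto y
  filter_upwards [h.eventually (hf (ε / 2) (half_pos hε))] with z hz
  have := hz y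
  rw [inv_mul_cancel_right] at this
  rw [dist_eq_norm]
  linarith

/-- The element of `LUC(G)` given by a function with the defining bounds. -/
def LUC.mk (f : G → ℂ) (C : ℝ) (hC : ∀ x, ‖f x‖ ≤ C)
    (hf : ∀ ε > 0, ∀ᶠ x in 𝓝 (1 : G), ∀ y, ‖f (x * y) - f y‖ ≤ ε) : LUC G :=
  ⟨BoundedContinuousFunction.ofNormedAddCommGroup f (continuous_of_left_uniform hf) C hC, hf⟩

@[simp] theorem LUC.mk_apply (f : G → ℂ) (C : ℝ) (hC : ∀ x, ‖f x‖ ≤ C)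
    (hf : ∀ ε > 0, ∀ᶠ x in 𝓝 (1 : G), ∀ y, ‖f (x * y) - f y‖ ≤ ε) (x : G) :
    LUC.mk f C hC hf x = f x := rfl

/-- The left translate `l_x f`, where `(l_x f)(y) = f (x y)`. -/
def leftTranslate (x : G) (f : LUC G) : LUC G :=
  LUC.mk (fun y => f (x * y)) ‖f‖ (fun y => LUC.norm_apply_le f _) (by
    intro ε hε
    have h : Tendsto (fun z => x * z * x⁻¹) (𝓝 1) (𝓝 1) := by
      have : Continuous fun z : G => x * z * x⁻¹ := by fun_prop
      simpa using this.tendsto 1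
    filter_upwards [h.eventually (f.2 ε hε)] with z hz y
    have := hz (x * y)
    rwa [show x * z * x⁻¹ * (x * y) = x * (z * y) by group] at this)

@[simp] theorem leftTranslate_apply (x : G) (f : LUC G) (y : G) :
    leftTranslate x f y = f (x * y) := rfl

/-- The action `n · f` of `n ∈ LUC(G)^*` on `f ∈ LUC(G)`: `(n · f)(x) = ⟨n, l_x f⟩`. -/
def act (n : StrongDual ℂ (LUC G)) (f : LUC G) : LUC G :=
  LUC.mk (fun x => n (leftTranslate x f)) (‖n‖ * ‖f‖)
    (fun x => (n.le_opNorm _).trans (by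
      gcongr
      exact LUC.norm_le (norm_nonneg _) fun y => LUC.norm_apply_le f _))
    (by
      intro ε hε
      filter_upwards [f.2 (ε / (‖n‖ + 1)) (by positivity)] with z hz y
      rw [← map_sub]
      have h : ‖leftTranslate (z * y) f - leftTranslate y f‖ ≤ ε / (‖n‖ + 1) :=
        LUC.norm_le (by positivity) fun t => by
          have := hz (y * t)
          rwa [← mul_assoc] at this
      calc _ ≤ ‖n‖ * (ε / (‖n‖ + 1)) := (n.le_opNorm _).trans (by gcongr)
        _ ≤ (‖n‖ + 1) * (ε / (‖n‖ + 1)) := by gcongr; linarith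
        _ = ε := by field_simp)

@[simp] theorem act_apply (n : StrongDual ℂ (LUC G)) (f : LUC G) (x : G) :
    act n f x = n (leftTranslate x f) := rfl

/-- The product of `LUC(G)^*`: `⟨m · n, f⟩ = ⟨m, n · f⟩`. -/
def lucMul (m n : StrongDual ℂ (LUC G)) : StrongDual ℂ (LUC G) :=
  LinearMap.mkContinuous
    { toFun := fun f => m (act n f)
      map_add' := fun f g => by
        rw [← map_add]
        congr 1
        refine LUC.ext fun x => ?_
        exact n.map_add (leftTranslate x f) (leftTranslate x g)
      map_smul' := fun c f => by
        rw [RingHom.id_apply, ← map_smul]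
        congr 1
        refine LUC.ext fun x => ?_
        exact n.map_smul c (leftTranslate x f) }
    (‖m‖ * ‖n‖)
    (fun f => by
      rw [mul_assoc]
      refine (m.le_opNorm _).trans ?_
      gcongr
      refine LUC.norm_le (by positivity) fun x => (n.le_opNorm _).trans ?_
      gcongr
      exact LUC.norm_le (norm_nonneg _) fun y => LUC.norm_apply_le f _)

@[simp] theorem lucMul_apply (m n : StrongDual ℂ (LUC G)) (f : LUC G) :
    lucMul m n f = m (act n f) := rfl

/-- The measure algebra `M(G)`, as a subset of `LUC(G)^*`: the functionals `f ↦ ∫ f dν` with `ν` a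
regular complex Borel measure on `G` (of finite total variation, as every complex measure is). -/
def measureAlgebra [MeasurableSpace G] [BorelSpace G] : Set (StrongDual ℂ (LUC G)) :=
  {m | ∃ ν : ComplexMeasure G, IsFiniteMeasure ν.variation ∧ ν.variation.Regular ∧
    ∀ f : LUC G, m f = ν.integral f (ContinuousLinearMap.mul ℝ ℂ)}

end LUC

section L1

open scoped Pointwise

set_option linter.unusedSectionVars false

variable {G : Type*} [Group G] [TopologicalSpace G] [IsTopologicalGroup G] [LocallyCompactSpace G]
  [MeasurableSpace G] [BorelSpace G] (μ : Measure G) [μ.IsHaarMeasure] [μ.Regular]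

theorem map_mul_right_eq (x : G) : μ.map (· * x) = modularCharacterFun x • μ := by
  have : (μ.map (· * x)).Regular := Regular.map (Homeomorph.mulRight x)
  rw [modularCharacterFun_eq_haarScalarFactor μ x]
  exact isMulLeftInvariant_eq_smul_of_regular _ μ

theorem modular_mul_modular_inv (x : G) :
    modularCharacterFun x * modularCharacterFun x⁻¹ = 1 := by
  rw [← modularCharacterFun_map_mul, mul_inv_cancel, modularCharacterFun_map_one]

theorem integral_comp_mul_right {E : Type*} [NormedAddCommGroup E] [NormedSpace ℝ E]
    (F : G → E) (x : G) : ∫ y, F (y * x) ∂μ = modularCharacterFun x • ∫ y, F y ∂μ := by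
  have := (MeasurableEquiv.mulRight x).measurableEmbedding.integral_map (μ := μ) F
  simp only [MeasurableEquiv.coe_mulRight] at this
  rw [← this, map_mul_right_eq, integral_smul_nnreal_measure]

theorem memLp_rightTranslate (x : G) (f : Lp ℂ 1 μ) :
    MemLp (fun y => (modularCharacterFun x : ℂ) * f (y * x⁻¹)) 1 μ := by
  refine MemLp.const_mul ?_ _
  have h : MemLp f 1 (μ.map (· * x⁻¹)) := by
    rw [map_mul_right_eq]
    exact (Lp.memLp f).smul_measure ENNReal.coe_ne_top
  exact h.comp_of_map (measurable_mul_const x⁻¹).aemeasurable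

/-- The left translate `δ_x * g` of `g ∈ L₁(G)`, i.e. `(δ_x * g)(t) = g (x⁻¹ t)`. -/
def diracConv (x : G) (g : Lp ℂ 1 μ) : Lp ℂ 1 μ :=
  Lp.compMeasurePreserving (fun t => x⁻¹ * t) (measurePreserving_mul_left μ x⁻¹) g

/-- The convolution `f * δ_x` of `f ∈ L₁(G)` with a point mass, i.e.
`(f * δ_x)(t) = c f (t x⁻¹)`, where the modular factor `c` is the one that makes `f ↦ f * δ_x`
isometric on `L₁(G)`. -/
def convDirac (f : Lp ℂ 1 μ) (x : G) : Lp ℂ 1 μ :=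
  (memLp_rightTranslate μ x f).toLp _

theorem coeFn_diracConv (x : G) (g : Lp ℂ 1 μ) : diracConv μ x g =ᵐ[μ] fun t => g (x⁻¹ * t) :=
  Lp.coeFn_compMeasurePreserving _ _

theorem coeFn_convDirac (f : Lp ℂ 1 μ) (x : G) :
    convDirac μ f x =ᵐ[μ] fun t => (modularCharacterFun x : ℂ) * f (t * x⁻¹) :=
  MemLp.coeFn_toLp _

theorem ae_comp_mul_right {p : G → Prop} (h : ∀ᵐ t ∂μ, p t) (x : G) : ∀ᵐ t ∂μ, p (t * x) := by
  refine ae_of_ae_map (measurable_mul_const x).aemeasurable ?_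
  rw [map_mul_right_eq]
  exact Measure.ae_smul_measure h _

theorem norm_diracConv (x : G) (g : Lp ℂ 1 μ) : ‖diracConv μ x g‖ = ‖g‖ :=
  Lp.norm_compMeasurePreserving _ _

theorem norm_convDirac (f : Lp ℂ 1 μ) (x : G) : ‖convDirac μ f x‖ = ‖f‖ := by
  have h : (fun t => ‖convDirac μ f x t‖) =ᵐ[μ]
      fun t => ‖(modularCharacterFun x : ℂ)‖ * ‖f (t * x⁻¹)‖ := by
    filter_upwards [coeFn_convDirac μ f x] with t ht
    rw [ht, norm_mul]
  rw [L1.norm_eq_integral_norm, L1.norm_eq_integral_norm, integral_congr_ae h]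
  rw [integral_const_mul, integral_comp_mul_right μ (fun t => ‖f t‖) x⁻¹, NNReal.smul_def,
    smul_eq_mul, ← mul_assoc]
  have := congrArg NNReal.toReal (modular_mul_modular_inv x)
  simp only [NNReal.coe_mul, NNReal.coe_one] at this
  simp [this]

theorem diracConv_add (x : G) (f g : Lp ℂ 1 μ) :
    diracConv μ x (f + g) = diracConv μ x f + diracConv μ x g := map_add _ _ _

theorem diracConv_sub (x : G) (f g : Lp ℂ 1 μ) :
    diracConv μ x (f - g) = diracConv μ x f - diracConv μ x g := map_sub _ _ _

theorem convDirac_add (f g : Lp ℂ 1 μ) (x : G) :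
    convDirac μ (f + g) x = convDirac μ f x + convDirac μ g x := by
  refine Lp.ext ?_
  filter_upwards [coeFn_convDirac μ (f + g) x, coeFn_convDirac μ f x, coeFn_convDirac μ g x,
    Lp.coeFn_add (convDirac μ f x) (convDirac μ g x),
    ae_comp_mul_right μ (Lp.coeFn_add f g) x⁻¹] with t h1 h2 h3 h4 h5
  simp only [h1, h4, h5, Pi.add_apply, h2, h3]
  ring

theorem convDirac_smul (c : ℂ) (f : Lp ℂ 1 μ) (x : G) :
    convDirac μ (c • f) x = c • convDirac μ f x := by
  refine Lp.ext ?_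
  filter_upwards [coeFn_convDirac μ (c • f) x, coeFn_convDirac μ f x,
    Lp.coeFn_smul c (convDirac μ f x),
    ae_comp_mul_right μ (Lp.coeFn_smul c f) x⁻¹] with t h1 h2 h4 h5
  simp only [h1, h4, h5, Pi.smul_apply, h2, smul_eq_mul]
  ring

theorem convDirac_sub (f g : Lp ℂ 1 μ) (x : G) :
    convDirac μ (f - g) x = convDirac μ f x - convDirac μ g x := by
  rw [sub_eq_add_neg, sub_eq_add_neg, convDirac_add, ← neg_one_smul ℂ g, convDirac_smul,
    neg_one_smul]

theorem convDirac_convDirac (f : Lp ℂ 1 μ) (x y : G) :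
    convDirac μ (convDirac μ f x) y = convDirac μ f (x * y) := by
  refine Lp.ext ?_
  filter_upwards [coeFn_convDirac μ (convDirac μ f x) y, coeFn_convDirac μ f (x * y),
    ae_comp_mul_right μ (coeFn_convDirac μ f x) y⁻¹] with t h1 h2 h3
  rw [h1, h2, h3, modularCharacterFun_map_mul]
  simp only [mul_inv_rev, mul_assoc, NNReal.coe_mul, Complex.ofReal_mul]
  ring

/-- The classes of continuous functions with compact support are dense in `L₁(G)`. -/
theorem dense_continuous_compactSupport :
    Dense {f : Lp ℂ 1 μ | ∃ k : G → ℂ, Continuous k ∧ HasCompactSupport k ∧ f =ᵐ[μ] k} := by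
  intro f
  rw [EMetric.mem_closure_iff]
  intro ε hε
  obtain ⟨δ, hδ, hδε⟩ := exists_between hε
  obtain ⟨g, hg, hgc⟩ : ∃ g : G → ℂ, eLpNorm (⇑f - g) 1 μ ≤ δ ∧
      (Continuous g ∧ HasCompactSupport g) := by
    refine (Lp.memLp f).induction_dense ENNReal.one_ne_top (fun g => Continuous g ∧ HasCompactSupport g)
      ?_ ?_ ?_ hδ.ne'
    · intro c t ht htμ ε hε
      obtain ⟨η, ηpos, hη⟩ := exists_eLpNorm_indicator_le (μ := μ) (p := 1) (by simp) c hε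
      have hη0 : (η : ℝ≥0∞) / 2 ≠ 0 := by
        simpa using ηpos.ne'
      obtain ⟨K, Kt, K_compact, K_closed, μK⟩ :
          ∃ K, K ⊆ t ∧ IsCompact K ∧ IsClosed K ∧ μ (t \ K) < η / 2 :=
        ht.exists_isCompact_isClosed_sdiff_lt htμ.ne hη0
      obtain ⟨U, tU, U_open, U_fin, μU⟩ : ∃ U, U ⊇ t ∧ IsOpen U ∧ μ U < ∞ ∧ μ (U \ t) < η / 2 :=
        ht.exists_isOpen_sdiff_lt htμ.ne hη0
      obtain ⟨k, k1, k0, k_supp, k01⟩ := exists_continuous_one_zero_of_isCompact K_compact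
        U_open.isClosed_compl (Set.disjoint_compl_right_iff_subset.2 (Kt.trans tU))
      refine ⟨fun x => (k x : ℂ) * c, ?_, by fun_prop, ?_⟩
      · refine (eLpNorm_mono (g := (U \ K).indicator fun _ => c) fun x => ?_).trans (hη _ ?_)
        · by_cases hU : x ∈ U
          · by_cases hK : x ∈ K
            · simp [hU, hK, Kt hK, k1 hK]
            · have := k01 x
              rw [Set.indicator_of_mem (show x ∈ U \ K from ⟨hU, hK⟩)]
              simp only [Pi.sub_apply]
              by_cases hxt : x ∈ t
              · rw [Set.indicator_of_mem hxt, show (k x : ℂ) * c - c = ((k x - 1 : ℝ) : ℂ) * c by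
                  push_cast; ring, norm_mul, Complex.norm_real, Real.norm_eq_abs]
                exact mul_le_of_le_one_left (norm_nonneg _) (abs_le.2 ⟨by linarith [this.1],
                  by linarith [this.2]⟩)
              · rw [Set.indicator_of_notMem hxt, sub_zero, norm_mul, Complex.norm_real,
                  Real.norm_eq_abs]
                exact mul_le_of_le_one_left (norm_nonneg _) (abs_le.2 ⟨by linarith [this.1],
                  by linarith [this.2]⟩)
          · have h0 : k x = 0 := k0 hU
            simp [h0, hU, show x ∉ t from fun h => hU (tU h)]
        · calc μ (U \ K) ≤ μ ((U \ t) ∪ (t \ K)) := measure_mono fun x hx => by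
                by_cases h : x ∈ t
                · exact Or.inr ⟨h, hx.2⟩
                · exact Or.inl ⟨hx.1, h⟩
            _ ≤ μ (U \ t) + μ (t \ K) := measure_union_le _ _
            _ ≤ η / 2 + η / 2 := by gcongr
            _ = η := ENNReal.add_halves _
      · exact HasCompactSupport.mul_right (f := fun x => (k x : ℂ))
          (k_supp.comp_left (g := fun r : ℝ => (r : ℂ)) (by simp))
    · rintro f g ⟨hf, hf'⟩ ⟨hg, hg'⟩
      exact ⟨hf.add hg, hf'.add hg'⟩
    · rintro g ⟨hg, hg'⟩
      exact (hg.stronglyMeasurable_of_hasCompactSupport hg').aestronglyMeasurable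
  have hgm : MemLp g 1 μ := hgc.1.memLp_of_hasCompactSupport hgc.2
  refine ⟨hgm.toLp g, ⟨g, hgc.1, hgc.2, hgm.coeFn_toLp⟩, ?_⟩
  rw [Lp.edist_def]
  refine lt_of_le_of_lt (le_of_eq (eLpNorm_congr_ae ?_)) (hg.trans_lt hδε)
  filter_upwards [hgm.coeFn_toLp] with x hx
  simp [hx]

theorem continuous_diracConv (g : Lp ℂ 1 μ) : Continuous fun x => diracConv μ x g := by
  have : Continuous fun x : G => (⟨fun t => x⁻¹ * t, by fun_prop⟩ : C(G, G)) :=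
    ContinuousMap.continuous_of_continuous_uncurry _ (by
      simp only [Function.uncurry_def, ContinuousMap.coe_mk]; fun_prop)
  exact Continuous.compMeasurePreservingLp (f := fun _ : G => g) continuous_const this
    (fun x => measurePreserving_mul_left μ x⁻¹) (by simp)

theorem continuous_integral_of_compact {X E : Type*} [TopologicalSpace X] [LocallyCompactSpace X]
    [NormedAddCommGroup E] [NormedSpace ℝ E] {F : X → G → E} (hF : Continuous (Function.uncurry F))
    (hK : ∀ T : Set X, IsCompact T → ∃ K : Set G, IsCompact K ∧ ∀ x ∈ T, ∀ y, y ∉ K → F x y = 0) :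
    Continuous fun x => ∫ y, F x y ∂μ := by
  rw [continuous_iff_continuousAt]
  intro x₀
  obtain ⟨T, hT, hx⟩ := exists_compact_mem_nhds x₀
  obtain ⟨K, hKc, h0⟩ := hK T hT
  exact (continuousOn_integral_of_compact_support hKc hF.continuousOn
    (fun p y hp hy => h0 p hp y hy)).continuousAt hx

theorem eq_zero_of_notMem_mul {E : Type*} [Zero E] {k : G → E} {T : Set G} {x y : G}
    (hx : x ∈ T) (hy : y ∉ tsupport k * T) : k (y * x⁻¹) = 0 := by
  by_contra h
  exact hy ⟨y * x⁻¹, subset_tsupport k h, x, hx, by simp⟩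

theorem continuous_modular : Continuous (modularCharacterFun : G → ℝ≥0) := by
  obtain ⟨⟨k, k_cont⟩, k_supp, k_nonneg, k_one⟩ :
    ∃ f : C(G, ℝ), HasCompactSupport f ∧ 0 ≤ f ∧ f 1 ≠ 0 := exists_continuous_nonneg_pos 1
  let μ : Measure G := MeasureTheory.Measure.haar
  have hk : 0 < ∫ y, k y ∂μ :=
    k_cont.integral_pos_of_hasCompactSupport_nonneg_nonzero k_supp k_nonneg k_one
  have hc : Continuous fun x : G => ∫ y, k (y * x) ∂μ := by
    refine continuous_integral_of_compact μ (F := fun x y => k (y * x))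
      (k_cont.comp (continuous_snd.mul continuous_fst)) fun T hT =>
      ⟨tsupport k * T⁻¹, k_supp.isCompact.mul hT.inv, fun x hx y hy => ?_⟩
    simpa using eq_zero_of_notMem_mul (k := k) (Set.inv_mem_inv.2 hx) hy
  refine NNReal.isEmbedding_coe.continuous_iff.2 ?_
  have : (fun x : G => (modularCharacterFun x : ℝ)) =
      fun x => (∫ y, k (y * x) ∂μ) / ∫ y, k y ∂μ := by
    funext x
    rw [integral_comp_mul_right, NNReal.smul_def, smul_eq_mul, mul_div_cancel_right₀ _ hk.ne']
  change Continuous fun x : G => (modularCharacterFun x : ℝ)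
  rw [this]
  exact hc.div_const _

theorem continuous_convDirac (f : Lp ℂ 1 μ) : Continuous fun x => convDirac μ f x := by
  refine continuous_of_uniform_approx_of_continuous fun u hu => ?_
  obtain ⟨ε, hε, hεu⟩ := Metric.mem_uniformity_dist.1 hu
  obtain ⟨f', ⟨k, k_cont, k_supp, hk⟩, hd⟩ :=
    Metric.mem_closure_iff.1 (dense_continuous_compactSupport μ f) ε hε
  refine ⟨fun x => convDirac μ f' x, ?_, fun x => hεu ?_⟩
  · have hΔ := continuous_modular (G := G)
    rw [continuous_iff_continuousAt]
    intro x₀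
    rw [ContinuousAt, tendsto_iff_dist_tendsto_zero]
    have hc : Continuous fun x : G => ∫ t, ‖(modularCharacterFun x : ℂ) * k (t * x⁻¹) -
        (modularCharacterFun x₀ : ℂ) * k (t * x₀⁻¹)‖ ∂μ := by
      refine continuous_integral_of_compact μ (F := fun x t => ‖(modularCharacterFun x : ℂ) *
        k (t * x⁻¹) - (modularCharacterFun x₀ : ℂ) * k (t * x₀⁻¹)‖) ?_ fun T hT =>
        ⟨tsupport k * insert x₀ T, k_supp.isCompact.mul (hT.insert x₀), fun x hx t ht => ?_⟩
      · simp only [Function.uncurry_def]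
        fun_prop
      · rw [eq_zero_of_notMem_mul (Set.mem_insert_of_mem x₀ hx) ht,
          eq_zero_of_notMem_mul (Set.mem_insert x₀ T) ht]
        simp
    have h0 := hc.tendsto x₀
    simp only [sub_self, norm_zero, integral_zero] at h0
    refine h0.congr fun x => ?_
    rw [dist_eq_norm, L1.norm_eq_integral_norm]
    refine integral_congr_ae ?_
    filter_upwards [Lp.coeFn_sub (convDirac μ f' x) (convDirac μ f' x₀), coeFn_convDirac μ f' x,
      coeFn_convDirac μ f' x₀, ae_comp_mul_right μ hk x⁻¹, ae_comp_mul_right μ hk x₀⁻¹]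
      with t h1 h2 h3 h4 h5
    rw [h1, Pi.sub_apply, h2, h3, h4, h5]
  · rw [dist_eq_norm, ← convDirac_sub, norm_convDirac, ← dist_eq_norm]
    exact hd

theorem integrable_smul_of_continuous {X : Type*} [NormedAddCommGroup X] [NormedSpace ℂ X]
    (f : Lp ℂ 1 μ) {u : G → X} (hu : Continuous u) {C : ℝ} (hC : ∀ y, ‖u y‖ ≤ C) :
    Integrable (fun y => f y • u y) μ := by
  obtain ⟨s, hs, hlim⟩ := mem_closure_iff_seq_limit.1 (dense_continuous_compactSupport μ f)
  choose k k_cont k_supp hk using hs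
  obtain ⟨ns, -, hns⟩ := (tendstoInMeasure_of_tendsto_Lp hlim).exists_seq_tendsto_ae
  have hm : AEStronglyMeasurable (fun y => f y • u y) μ := by
    refine aestronglyMeasurable_of_tendsto_ae atTop (f := fun n y => s (ns n) y • u y)
      (fun n => ?_) ?_
    · refine AEStronglyMeasurable.congr (f := fun y => k (ns n) y • u y) ?_ ?_
      · exact (((k_cont (ns n)).smul hu).stronglyMeasurable_of_hasCompactSupport
          (k_supp (ns n)).smul_right).aestronglyMeasurable
      · filter_upwards [hk (ns n)] with y hy
        rw [hy]
    · filter_upwards [hns] with y hy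
      exact hy.smul_const _
  refine ((L1.integrable_coeFn f).norm.mul_const C).mono' hm (Eventually.of_forall fun y => ?_)
  rw [norm_smul]
  gcongr
  exact hC y

/-- The convolution `f * g = ∫ f(y) (δ_y * g) dy` of `f, g ∈ L₁(G)`, as an integral in `L₁(G)`;
that is, `(f * g)(t) = ∫ f(y) g(y⁻¹ t) dy`. -/
def conv (f g : Lp ℂ 1 μ) : Lp ℂ 1 μ := ∫ y, f y • diracConv μ y g ∂μ

theorem integrable_conv (f g : Lp ℂ 1 μ) : Integrable (fun y => f y • diracConv μ y g) μ :=
  integrable_smul_of_continuous μ f (continuous_diracConv μ g)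
    fun y => (norm_diracConv μ y g).le

theorem integrable_conv' (f g : Lp ℂ 1 μ) : Integrable (fun x => g x • convDirac μ f x) μ :=
  integrable_smul_of_continuous μ g (continuous_convDirac μ f)
    fun y => (norm_convDirac μ f y).le

/-- The measure `Δ(y) dy`, reflected; it coincides with the Haar measure on test functions. -/
theorem integral_reflect {F : G → ℝ} (hF : Continuous F) (hF' : HasCompactSupport F) :
    ∫ y, (modularCharacterFun y : ℝ) * F y⁻¹ ∂μ = ∫ y, F y ∂μ := by
  have hΔ := continuous_modular (G := G)
  set w : Measure G := μ.withDensity fun y => (modularCharacterFun y : ℝ≥0∞) with hw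
  have hw_right (g : G) : w.map (· * g) = w := by
    ext A hA
    have hA' : MeasurableSet ((· * g) ⁻¹' A) := measurable_mul_const g hA
    rw [Measure.map_apply (measurable_mul_const g) hA, hw, withDensity_apply _ hA',
      withDensity_apply _ hA, ← lintegral_indicator hA', ← lintegral_indicator hA]
    have h1 : (((· * g) ⁻¹' A).indicator fun y => (modularCharacterFun y : ℝ≥0∞)) =
        fun y => (modularCharacterFun g⁻¹ : ℝ≥0∞) *
          (A.indicator (fun y => (modularCharacterFun y : ℝ≥0∞)) (y * g)) := by
      funext y
      by_cases hy : y * g ∈ A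
      · rw [Set.indicator_of_mem hy, Set.indicator_of_mem (show y ∈ (· * g) ⁻¹' A from hy),
          modularCharacterFun_map_mul, ENNReal.coe_mul, mul_left_comm, ← ENNReal.coe_mul,
          mul_comm (modularCharacterFun g⁻¹), modular_mul_modular_inv, ENNReal.coe_one, mul_one]
      · rw [Set.indicator_of_notMem hy, Set.indicator_of_notMem (show y ∉ (· * g) ⁻¹' A from hy),
          mul_zero]
    have hm : Measurable (A.indicator fun y => (modularCharacterFun y : ℝ≥0∞)) :=
      hΔ.measurable.coe_nnreal_ennreal.indicator hA
    have hm' : Measurable fun y =>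
        A.indicator (fun y => (modularCharacterFun y : ℝ≥0∞)) (y * g) :=
      hm.comp (measurable_mul_const g)
    rw [h1, lintegral_const_mul _ hm', ← lintegral_map hm (measurable_mul_const g), map_mul_right_eq, lintegral_smul_measure,
      ENNReal.smul_def, smul_eq_mul, ← mul_assoc, ← ENNReal.coe_mul,
      mul_comm (modularCharacterFun g⁻¹), modular_mul_modular_inv, ENNReal.coe_one, one_mul]
  have : IsLocallyFiniteMeasure w := IsLocallyFiniteMeasure.withDensity_coe hΔ
  set ν : Measure G := w.map Inv.inv with hν
  have : IsFiniteMeasureOnCompacts ν := IsFiniteMeasureOnCompacts.map w (Homeomorph.inv G)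
  have : ν.IsMulLeftInvariant := by
    refine ⟨fun g => ?_⟩
    rw [hν, Measure.map_map (measurable_const_mul g) measurable_inv]
    conv_rhs => rw [← hw_right g⁻¹, Measure.map_map measurable_inv (measurable_mul_const g⁻¹)]
    congr 1
    funext y
    simp
  have hint (F : G → ℝ) : ∫ y, F y ∂ν = ∫ y, (modularCharacterFun y : ℝ) * F y⁻¹ ∂μ := by
    have h := (MeasurableEquiv.inv G).measurableEmbedding.integral_map (μ := w) F
    change ∫ y, F y ∂ν = ∫ y, F y⁻¹ ∂w at h
    rw [h, hw, integral_withDensity_eq_integral_smul hΔ.measurable]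
    rfl
  have huniq {F : G → ℝ} (hF : Continuous F) (hF' : HasCompactSupport F) :
      ∫ y, (modularCharacterFun y : ℝ) * F y⁻¹ ∂μ = (ν.haarScalarFactor μ : ℝ) * ∫ y, F y ∂μ := by
    rw [← hint, integral_isMulLeftInvariant_eq_smul_of_hasCompactSupport ν μ hF hF',
      integral_smul_nnreal_measure, NNReal.smul_def, smul_eq_mul]
  obtain ⟨⟨k, k_cont⟩, k_supp, k_nonneg, k_one⟩ :
    ∃ f : C(G, ℝ), HasCompactSupport f ∧ 0 ≤ f ∧ f 1 ≠ 0 := exists_continuous_nonneg_pos 1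
  let F₀ : G → ℝ := fun y => k y * (k y⁻¹ * √(modularCharacterFun y : ℝ))
  have hF₀ : Continuous F₀ := by fun_prop
  have hF₀' : HasCompactSupport F₀ := HasCompactSupport.mul_right k_supp
  have hpos : 0 < ∫ y, F₀ y ∂μ := by
    refine hF₀.integral_pos_of_hasCompactSupport_nonneg_nonzero (x := 1) hF₀' (fun y => ?_) ?_
    · exact mul_nonneg (k_nonneg y) (mul_nonneg (k_nonneg y⁻¹) (Real.sqrt_nonneg _))
    · simpa [F₀, modularCharacterFun_map_one] using k_one
  have h0 := huniq hF₀ hF₀'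
  have hsymm (y : G) : (modularCharacterFun y : ℝ) * F₀ y⁻¹ = F₀ y := by
    have h1 : (modularCharacterFun y : ℝ) * (modularCharacterFun y⁻¹ : ℝ) = 1 := by
      exact_mod_cast congrArg NNReal.toReal (modular_mul_modular_inv y)
    have h2 : √(modularCharacterFun y : ℝ) * √(modularCharacterFun y⁻¹ : ℝ) = 1 := by
      rw [← Real.sqrt_mul (NNReal.coe_nonneg _), h1, Real.sqrt_one]
    have h3 : √(modularCharacterFun y : ℝ) * √(modularCharacterFun y : ℝ) =
      modularCharacterFun y := Real.mul_self_sqrt (NNReal.coe_nonneg _)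
    simp only [F₀, inv_inv]
    linear_combination (k y * k y⁻¹ * √(modularCharacterFun y : ℝ)) * h2 -
      (k y * k y⁻¹ * √(modularCharacterFun y⁻¹ : ℝ)) * h3
  simp only [hsymm] at h0
  have hc : (ν.haarScalarFactor μ : ℝ) = 1 := by
    have : ((ν.haarScalarFactor μ : ℝ) - 1) * ∫ y, F₀ y ∂μ = 0 := by linarith
    have := (mul_eq_zero.1 this).resolve_right hpos.ne'
    linarith
  rw [huniq hF hF', hc, one_mul]

theorem integral_comp_inv {F : G → ℂ} (hF : Continuous F) (hF' : HasCompactSupport F) :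
    ∫ y, F y⁻¹ ∂μ = ∫ y, (modularCharacterFun y : ℂ) * F y ∂μ := by
  have hΔ := continuous_modular (G := G)
  let H : G → ℂ := fun y => (modularCharacterFun y : ℂ) * F y
  have hH : Continuous H := by fun_prop
  have hH' : HasCompactSupport H := HasCompactSupport.mul_left hF'
  have hF'' : HasCompactSupport fun y => F y⁻¹ := hF'.comp_homeomorph (Homeomorph.inv G)
  have hFi : Continuous fun y => F y⁻¹ := by fun_prop
  have key (y : G) : (modularCharacterFun y : ℂ) * H y⁻¹ = F y⁻¹ := by
    have h1 : (modularCharacterFun y : ℂ) * (modularCharacterFun y⁻¹ : ℂ) = 1 := by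
      exact_mod_cast congrArg NNReal.toReal (modular_mul_modular_inv y)
    simp only [H]
    rw [← mul_assoc, h1, one_mul]
  have hre := integral_reflect μ (F := fun y => (H y).re) (Complex.continuous_re.comp hH)
    (hH'.comp_left (g := Complex.re) rfl)
  have him := integral_reflect μ (F := fun y => (H y).im) (Complex.continuous_im.comp hH)
    (hH'.comp_left (g := Complex.im) rfl)
  have e1 (y : G) : (modularCharacterFun y : ℝ) * (H y⁻¹).re = (F y⁻¹).re := by
    rw [← key]; simp
  have e2 (y : G) : (modularCharacterFun y : ℝ) * (H y⁻¹).im = (F y⁻¹).im := by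
    rw [← key]; simp
  simp only [e1, e2] at hre him
  have iF := hFi.integrable_of_hasCompactSupport (μ := μ) hF''
  have iH := hH.integrable_of_hasCompactSupport (μ := μ) hH'
  have a1 := integral_re_add_im iF
  have a2 := integral_re_add_im iH
  simp only [RCLike.re_to_complex, RCLike.im_to_complex] at a1 a2
  rw [← a1, hre, him, a2]

theorem conv_kernel_eq {k l : G → ℂ} (hk : Continuous k)
    (hl : Continuous l) (hl' : HasCompactSupport l) (t : G) :
    ∫ y, k y * l (y⁻¹ * t) ∂μ = ∫ x, l x * ((modularCharacterFun x : ℂ) * k (t * x⁻¹)) ∂μ := by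
  rw [← integral_mul_left_eq_self (fun y => k y * l (y⁻¹ * t)) t]
  have := integral_comp_inv μ (F := fun x => k (t * x⁻¹) * l x) (by fun_prop)
    (HasCompactSupport.mul_left hl')
  simp only [inv_inv] at this
  simp only [mul_inv_rev, inv_mul_cancel_right]
  rw [this]
  congr 1
  funext x
  ring

/-- Integration over a measurable set, as a functional on `L₁(G)`. -/
def setInt (S : Set G) : Lp ℂ 1 μ →L[ℂ] ℂ :=
  LinearMap.mkContinuous
    { toFun := fun f => ∫ t in S, f t ∂μ
      map_add' := fun f g => by
        rw [← integral_add (L1.integrable_coeFn f).integrableOn (L1.integrable_coeFn g).integrableOn]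
        exact integral_congr_ae (ae_restrict_of_ae (Lp.coeFn_add f g))
      map_smul' := fun c f => by
        rw [RingHom.id_apply, smul_eq_mul, ← integral_const_mul]
        exact integral_congr_ae (ae_restrict_of_ae (Lp.coeFn_smul c f)) }
    1 (fun f => by
      rw [one_mul, L1.norm_eq_integral_norm]
      refine (norm_integral_le_integral_norm _).trans ?_
      exact setIntegral_le_integral (L1.integrable_coeFn f).norm
        (Eventually.of_forall fun _ => norm_nonneg _))

theorem setInt_apply (S : Set G) (f : Lp ℂ 1 μ) : setInt μ S f = ∫ t in S, f t ∂μ := rfl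

/-- The convolution is also given by `f * g = ∫ g(x) (f * δ_x) dx`. -/
theorem conv_eq_of_compactSupport {f g : Lp ℂ 1 μ} {k l : G → ℂ} (hk : Continuous k)
    (hk' : HasCompactSupport k) (hl : Continuous l) (hl' : HasCompactSupport l)
    (hf : f =ᵐ[μ] k) (hg : g =ᵐ[μ] l) : conv μ f g = ∫ x, g x • convDirac μ f x ∂μ := by
  have hΔ := continuous_modular (G := G)
  refine Lp.ext (Lp.ae_eq_of_forall_setIntegral_eq _ _ one_ne_zero ENNReal.one_ne_top
    (fun s _ _ => (L1.integrable_coeFn _).integrableOn)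
    (fun s _ _ => (L1.integrable_coeFn _).integrableOn) fun S hS hSμ => ?_)
  have hfin : IsFiniteMeasureOnCompacts (μ.restrict S) := inferInstance
  rw [← setInt_apply, ← setInt_apply, conv, ← (setInt μ S).integral_comp_comm (integrable_conv μ f g),
    ← (setInt μ S).integral_comp_comm (integrable_conv' μ f g)]
  have h1 : ∀ᵐ y ∂μ, setInt μ S (f y • diracConv μ y g) = ∫ t in S, k y * l (y⁻¹ * t) ∂μ := by
    filter_upwards [hf] with y hy
    rw [map_smul, setInt_apply, smul_eq_mul, hy, integral_const_mul]
    congr 1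
    refine integral_congr_ae (ae_restrict_of_ae ?_)
    filter_upwards [coeFn_diracConv μ y g,
      (measurePreserving_mul_left μ y⁻¹).quasiMeasurePreserving.ae hg] with t h2 h3
    rw [h2, h3]
  have h2 : ∀ᵐ x ∂μ, setInt μ S (g x • convDirac μ f x) =
      ∫ t in S, l x * ((modularCharacterFun x : ℂ) * k (t * x⁻¹)) ∂μ := by
    filter_upwards [hg] with x hx
    rw [map_smul, setInt_apply, smul_eq_mul, hx, integral_const_mul]
    congr 1
    refine integral_congr_ae (ae_restrict_of_ae ?_)
    filter_upwards [coeFn_convDirac μ f x, ae_comp_mul_right μ hf x⁻¹] with t h2 h3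
    rw [h2, h3]
  rw [integral_congr_ae h1, integral_congr_ae h2,
    integral_integral_swap_of_hasCompactSupport (f := fun y t => k y * l (y⁻¹ * t)),
    integral_integral_swap_of_hasCompactSupport
      (f := fun x t => l x * ((modularCharacterFun x : ℂ) * k (t * x⁻¹)))]
  · simp only [conv_kernel_eq μ hk hl hl']
  · simp only [Function.uncurry_def]; fun_prop
  · refine HasCompactSupport.intro (hl'.isCompact.prod (hk'.isCompact.mul hl'.isCompact)) ?_
    rintro ⟨x, t⟩ hxt
    simp only [Function.uncurry_apply_pair]
    by_contra h
    obtain ⟨ha, hb⟩ := mul_ne_zero_iff.1 h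
    refine hxt ⟨subset_tsupport l ha, t * x⁻¹, subset_tsupport k (right_ne_zero_of_mul hb), x,
      subset_tsupport l ha, by simp⟩
  · simp only [Function.uncurry_def]; fun_prop
  · refine HasCompactSupport.intro (hk'.isCompact.prod (hk'.isCompact.mul hl'.isCompact)) ?_
    rintro ⟨y, t⟩ hxt
    simp only [Function.uncurry_apply_pair]
    by_contra h
    obtain ⟨ha, hb⟩ := mul_ne_zero_iff.1 h
    refine hxt ⟨subset_tsupport k ha, y, subset_tsupport k ha, y⁻¹ * t,
      subset_tsupport l hb, by simp⟩

theorem norm_integral_smul_le {X : Type*} [NormedAddCommGroup X] [NormedSpace ℂ X]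
    (f : Lp ℂ 1 μ) {u : G → X} {C : ℝ} (hC : ∀ y, ‖u y‖ ≤ C) :
    ‖∫ y, f y • u y ∂μ‖ ≤ C * ‖f‖ := by
  rw [L1.norm_eq_integral_norm, ← integral_const_mul]
  refine norm_integral_le_of_norm_le ((L1.integrable_coeFn f).norm.const_mul C)
    (Eventually.of_forall fun y => ?_)
  rw [norm_smul, mul_comm]
  gcongr
  exact hC y

theorem integral_sub_smul {X : Type*} [NormedAddCommGroup X] [NormedSpace ℂ X]
    (f f' : Lp ℂ 1 μ) {u : G → X} (hu : Continuous u) {C : ℝ} (hC : ∀ y, ‖u y‖ ≤ C) :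
    ∫ y, (f - f') y • u y ∂μ = ∫ y, f y • u y ∂μ - ∫ y, f' y • u y ∂μ := by
  rw [← integral_sub (integrable_smul_of_continuous μ f hu hC)
    (integrable_smul_of_continuous μ f' hu hC)]
  refine integral_congr_ae ?_
  filter_upwards [Lp.coeFn_sub f f'] with y hy
  rw [hy, Pi.sub_apply, sub_smul]

theorem continuous_integral_smul {X : Type*} [NormedAddCommGroup X] [NormedSpace ℂ X]
    {u : G → X} (hu : Continuous u) {C : ℝ} (hC : ∀ y, ‖u y‖ ≤ C) :
    Continuous fun f : Lp ℂ 1 μ => ∫ y, f y • u y ∂μ := by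
  refine (LipschitzWith.of_dist_le_mul (K := C.toNNReal) fun f f' => ?_).continuous
  rw [dist_eq_norm, dist_eq_norm, ← integral_sub_smul μ f f' hu hC]
  refine norm_integral_smul_le μ _ fun y => (hC y).trans (Real.le_coe_toNNReal C)

theorem continuous_integral_smul' (f : Lp ℂ 1 μ) {u : Lp ℂ 1 μ → G → Lp ℂ 1 μ}
    (hu : ∀ g, Continuous (u g)) (hn : ∀ g y, ‖u g y‖ = ‖g‖)
    (hs : ∀ g g' y, u (g - g') y = u g y - u g' y) :
    Continuous fun g => ∫ y, f y • u g y ∂μ := by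
  refine (LipschitzWith.of_dist_le_mul (K := ‖f‖₊) fun g g' => ?_).continuous
  rw [dist_eq_norm, dist_eq_norm, ← integral_sub
    (integrable_smul_of_continuous μ f (hu g) fun y => (hn g y).le)
    (integrable_smul_of_continuous μ f (hu g') fun y => (hn g' y).le)]
  simp only [← smul_sub, ← hs]
  rw [coe_nnnorm, mul_comm]
  exact norm_integral_smul_le μ f fun y => (hn _ y).le

/-- The convolution is also given by `f * g = ∫ g(x) (f * δ_x) dx`. -/
theorem conv_eq (f g : Lp ℂ 1 μ) : conv μ f g = ∫ x, g x • convDirac μ f x ∂μ := by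
  have c1 (g : Lp ℂ 1 μ) : Continuous fun f => conv μ f g :=
    continuous_integral_smul μ (continuous_diracConv μ g) fun y => (norm_diracConv μ y g).le
  have c2 (f : Lp ℂ 1 μ) : Continuous fun g => conv μ f g :=
    continuous_integral_smul' μ f (u := fun g y => diracConv μ y g) (continuous_diracConv μ)
      (fun g y => norm_diracConv μ y g) (fun g g' y => diracConv_sub μ y g g')
  have c3 (f : Lp ℂ 1 μ) : Continuous fun g : Lp ℂ 1 μ => ∫ x, g x • convDirac μ f x ∂μ :=
    continuous_integral_smul μ (continuous_convDirac μ f) fun y => (norm_convDirac μ f y).le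
  have c4 (g : Lp ℂ 1 μ) : Continuous fun f => ∫ x, g x • convDirac μ f x ∂μ :=
    continuous_integral_smul' μ g (u := fun f x => convDirac μ f x) (continuous_convDirac μ)
      (fun f x => norm_convDirac μ f x) (fun f f' x => convDirac_sub μ f f' x)
  have hd := dense_continuous_compactSupport μ
  have h1 : ∀ g : Lp ℂ 1 μ, (∃ l : G → ℂ, Continuous l ∧ HasCompactSupport l ∧ g =ᵐ[μ] l) →
      ∀ f, conv μ f g = ∫ x, g x • convDirac μ f x ∂μ := by
    rintro g ⟨l, hl, hl', hg⟩
    refine fun f => congrFun (Continuous.ext_on hd (c1 g) (c4 g) ?_) f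
    rintro f ⟨k, hk, hk', hf⟩
    exact conv_eq_of_compactSupport μ hk hk' hl hl' hf hg
  exact congrFun (Continuous.ext_on hd (c2 f) (c3 f) fun g hg => h1 g hg f) g

/-- The module operation `h ⊙ f ∈ LUC(G)` of `f ∈ L₁(G)` on `h ∈ L_∞(G) = L₁(G)^*`, given by
`(h ⊙ f)(x) = ⟨h, f * δ_x⟩`. It is the function representing the functional `g ↦ ⟨h, f * g⟩` on
`L₁(G)`, see `odot_spec`. -/
def odot (h : StrongDual ℂ (Lp ℂ 1 μ)) (f : Lp ℂ 1 μ) : LUC G :=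
  LUC.mk (fun x => h (convDirac μ f x)) (‖h‖ * ‖f‖)
    (fun x => by
      rw [← norm_convDirac μ f x]
      exact h.le_opNorm _)
    (by
      intro ε hε
      have h0 : convDirac μ f 1 = f := by
        refine Lp.ext ?_
        filter_upwards [coeFn_convDirac μ f 1] with t ht
        rw [ht, modularCharacterFun_map_one]
        simp
      have ht := Metric.tendsto_nhds.1 ((continuous_convDirac μ f).tendsto 1) (ε / (‖h‖ + 1))
        (by positivity)
      filter_upwards [ht] with x hx y
      rw [h0, dist_eq_norm] at hx
      rw [← map_sub, ← convDirac_convDirac, ← convDirac_sub]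
      calc _ ≤ ‖h‖ * ‖convDirac μ f x - f‖ := by
            rw [← norm_convDirac μ (convDirac μ f x - f) y]
            exact h.le_opNorm _
        _ ≤ (‖h‖ + 1) * (ε / (‖h‖ + 1)) := by gcongr; linarith
        _ = ε := by field_simp)

@[simp] theorem odot_apply (h : StrongDual ℂ (Lp ℂ 1 μ)) (f : Lp ℂ 1 μ) (x : G) :
    odot μ h f x = h (convDirac μ f x) := rfl

/-- The defining relation `⟨h ⊙ f, g⟩ = ⟨h, f * g⟩`. -/
theorem odot_spec (h : StrongDual ℂ (Lp ℂ 1 μ)) (f g : Lp ℂ 1 μ) :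
    ∫ x, odot μ h f x * g x ∂μ = h (conv μ f g) := by
  rw [conv_eq, ← h.integral_comp_comm (integrable_conv' μ f g)]
  simp only [odot_apply, map_smul, smul_eq_mul, mul_comm]

theorem norm_odot_le (h : StrongDual ℂ (Lp ℂ 1 μ)) (f : Lp ℂ 1 μ) :
    ‖odot μ h f‖ ≤ ‖h‖ * ‖f‖ :=
  LUC.norm_le (by positivity) fun x => by
    rw [← norm_convDirac μ f x]
    exact h.le_opNorm _

/-- The module operation `m ◇ h ∈ L_∞(G) = L₁(G)^*` of `m ∈ LUC(G)^*` on `h ∈ L_∞(G)`: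
`⟨m ◇ h, g⟩ = ⟨m, h ⊙ g⟩`. -/
def diamond (m : StrongDual ℂ (LUC G)) (h : StrongDual ℂ (Lp ℂ 1 μ)) :
    StrongDual ℂ (Lp ℂ 1 μ) :=
  LinearMap.mkContinuous
    { toFun := fun g => m (odot μ h g)
      map_add' := fun f g => by
        rw [← map_add]
        congr 1
        refine LUC.ext fun x => ?_
        change h (convDirac μ (f + g) x) = h (convDirac μ f x) + h (convDirac μ g x)
        rw [convDirac_add, map_add]
      map_smul' := fun c f => by
        rw [RingHom.id_apply, ← map_smul]
        congr 1
        refine LUC.ext fun x => ?_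
        change h (convDirac μ (c • f) x) = c • h (convDirac μ f x)
        rw [convDirac_smul, map_smul] }
    (‖m‖ * ‖h‖)
    (fun g => by
      rw [mul_assoc]
      refine (m.le_opNorm _).trans ?_
      gcongr
      exact norm_odot_le μ h g)

@[simp] theorem diamond_apply (m : StrongDual ℂ (LUC G)) (h : StrongDual ℂ (Lp ℂ 1 μ))
    (g : Lp ℂ 1 μ) : diamond μ m h g = m (odot μ h g) := rfl

/-- The map `φ : LUC(G)^* → B(L_∞(G))`, `φ(m)(h) = m ◇ h`. -/
def phi (m : StrongDual ℂ (LUC G)) :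
    StrongDual ℂ (Lp ℂ 1 μ) →L[ℂ] StrongDual ℂ (Lp ℂ 1 μ) :=
  LinearMap.mkContinuous
    { toFun := fun h => diamond μ m h
      map_add' := fun h h' => by
        refine ContinuousLinearMap.ext fun g => ?_
        change m (odot μ (h + h') g) = m (odot μ h g) + m (odot μ h' g)
        rw [← map_add]
        rfl
      map_smul' := fun c h => by
        refine ContinuousLinearMap.ext fun g => ?_
        change m (odot μ (c • h) g) = c • m (odot μ h g)
        rw [← map_smul]
        rfl }
    ‖m‖
    (fun h => ContinuousLinearMap.opNorm_le_bound _ (by positivity) fun g => by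
      change ‖m (odot μ h g)‖ ≤ _
      rw [mul_assoc]
      refine (m.le_opNorm _).trans ?_
      gcongr
      exact norm_odot_le μ h g)

@[simp] theorem phi_apply (m : StrongDual ℂ (LUC G)) (h : StrongDual ℂ (Lp ℂ 1 μ)) :
    phi μ m h = diamond μ m h := rfl

/-- `B^σ(L_∞(G))`: the bounded operators on `L_∞(G) = L₁(G)^*` that are normal, i.e. continuous
from the weak-* topology to the weak-* topology. -/
def normalOperators : Set (StrongDual ℂ (Lp ℂ 1 μ) →L[ℂ] StrongDual ℂ (Lp ℂ 1 μ)) :=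
  {T | Continuous fun h : WeakDual ℂ (Lp ℂ 1 μ) =>
    StrongDual.toWeakDual (T (WeakDual.toStrongDual h))}

end L1

end LUCDual

end

/-!
Linearity, multiplicativity and `φ(δ_e) = id` are formal: they follow from
`(g * δ_x) * δ_y = g * δ_{xy}`, which says that `n · (h ⊙ g) = (n ◇ h) ⊙ g`.

For the isometry, a function `f ∈ LUC(G)` defines an element of `L_∞(G)`, and `f ⊙ g` is the average
`x ↦ ∫ g(t) f(t x) dt`. If `g ≥ 0` has integral one and is supported near the neutral element, then
`f ⊙ g` is uniformly close to `f` (`exists_norm_odot_sub_le`), so the values of `φ(m)` on such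
elements recover the norm of `m` (`norm_phi`).

If `ν` is a regular complex measure, then `⟨φ(ν) h, g⟩ = ∫ ⟨h, g * δ_x⟩ dν(x) = ⟨h, g * ν⟩`, where
`g * ν = ∫ (g * δ_x) dν(x)` is an integral in `L₁(G)`. So `φ(ν)` has a predual and is normal
(`phi_measureFunctional_mem`).

Conversely, let `φ(m)` be normal. By the Riesz representation theorem (`exists_complexMeasure`) there
is a regular complex measure `ν` that agrees with `m` on the functions with compact support. Then
`n = m - ν` vanishes on these functions and `φ(n)` is normal. If `g` has compact support and `K` is
compact, then `(h 1_K) ⊙ g` has compact support, so `⟨φ(n)(h 1_K), g⟩ = 0`. Since `h 1_K → h` in the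
weak-* topology as `K` increases, `φ(n) = 0`, and `n = 0` because `φ` is isometric
(`eq_zero_of_phi_mem_normalOperators`).

Mathlib has the Riesz theorem for positive functionals only. A bounded real functional `Λ` on
`C_c(X)` is reduced to these through its positive part `Λ⁺ f = sup {Λ g | 0 ≤ g ≤ f}`
(`exists_posPart_negPart`).
-/

noncomputable section

namespace LUCDual

/-! ### The isometric representation on `L_∞(G)` -/

section Representation

variable {G : Type*} [Group G] [TopologicalSpace G] [IsTopologicalGroup G] [LocallyCompactSpace G]
  [MeasurableSpace G] [BorelSpace G] (μ : Measure G) [μ.IsHaarMeasure] [μ.Regular]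

theorem convDirac_one (g : Lp ℂ 1 μ) : convDirac μ g 1 = g := by
  refine Lp.ext ?_
  filter_upwards [coeFn_convDirac μ g 1] with t ht
  simp [ht, modularCharacterFun_map_one]

theorem isLinearMap_phi : IsLinearMap ℂ (phi μ) :=
  ⟨fun _ _ => rfl, fun _ _ => rfl⟩

theorem phi_lucOne : phi μ lucOne = ContinuousLinearMap.id ℂ (StrongDual ℂ (Lp ℂ 1 μ)) := by
  ext h g
  change h (convDirac μ g 1) = h g
  rw [convDirac_one]

theorem leftTranslate_odot (h : StrongDual ℂ (Lp ℂ 1 μ)) (g : Lp ℂ 1 μ) (x : G) :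
    leftTranslate x (odot μ h g) = odot μ h (convDirac μ g x) :=
  LUC.ext fun y => by
    rw [leftTranslate_apply, odot_apply, odot_apply, convDirac_convDirac]

theorem odot_diamond (n : StrongDual ℂ (LUC G)) (h : StrongDual ℂ (Lp ℂ 1 μ)) (g : Lp ℂ 1 μ) :
    odot μ (diamond μ n h) g = act n (odot μ h g) :=
  LUC.ext fun x => by
    rw [odot_apply, diamond_apply, act_apply, leftTranslate_odot]

theorem phi_lucMul (m n : StrongDual ℂ (LUC G)) :
    phi μ (lucMul m n) = (phi μ m).comp (phi μ n) := by
  ext h g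
  change lucMul m n (odot μ h g) = m (odot μ (diamond μ n h) g)
  rw [odot_diamond, lucMul_apply]

/-- The functional `k ↦ ∫ f k` on `L₁(G)`, that is, the class of `f ∈ LUC(G)` in `L_∞(G)`. -/
def lucToDual (f : LUC G) : StrongDual ℂ (Lp ℂ 1 μ) :=
  LinearMap.mkContinuous
    { toFun := fun k => ∫ t, k t • f t ∂μ
      map_add' := fun k l => by
        rw [← integral_add
          (integrable_smul_of_continuous μ k (f : G →ᵇ ℂ).continuous (LUC.norm_apply_le f))
          (integrable_smul_of_continuous μ l (f : G →ᵇ ℂ).continuous (LUC.norm_apply_le f))]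
        refine integral_congr_ae ?_
        filter_upwards [Lp.coeFn_add k l] with t ht
        rw [ht, Pi.add_apply, add_smul]
      map_smul' := fun c k => by
        rw [RingHom.id_apply, ← integral_smul]
        refine integral_congr_ae ?_
        filter_upwards [Lp.coeFn_smul c k] with t ht
        rw [ht, Pi.smul_apply, smul_assoc] }
    ‖f‖ (fun k => norm_integral_smul_le μ k (LUC.norm_apply_le f))

theorem lucToDual_apply (f : LUC G) (k : Lp ℂ 1 μ) :
    lucToDual μ f k = ∫ t, k t • f t ∂μ := rfl

theorem norm_lucToDual_le (f : LUC G) : ‖lucToDual μ f‖ ≤ ‖f‖ :=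
  LinearMap.mkContinuous_norm_le _ (norm_nonneg _) _

/-- On classes of functions `f ∈ LUC(G)`, `⊙` averages the right translates of `f`: the modular
factor in `g * δ_x` cancels against the change of variables `t ↦ t x`. -/
theorem odot_lucToDual_apply (f : LUC G) (g : Lp ℂ 1 μ) (x : G) :
    odot μ (lucToDual μ f) g x = ∫ t, g t • f (t * x) ∂μ := by
  rw [odot_apply, lucToDual_apply]
  have h1 : ∫ t, convDirac μ g x t • f t ∂μ =
      (modularCharacterFun x : ℂ) * ∫ t, g (t * x⁻¹) • f t ∂μ := by
    rw [← integral_const_mul]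
    refine integral_congr_ae ?_
    filter_upwards [coeFn_convDirac μ g x] with t ht
    rw [ht, smul_eq_mul, smul_eq_mul, mul_assoc]
  have h2 := integral_comp_mul_right μ (fun t => g (t * x⁻¹) • f t) x
  simp only [mul_inv_cancel_right] at h2
  rw [h1, h2, NNReal.smul_def, Complex.real_smul]

/-- A bounded approximate identity of `L₁(G)`: a nonnegative `g` of integral one with support near
the neutral element moves `f` little, because `f` is left uniformly continuous. -/
theorem exists_norm_odot_sub_le (f : LUC G) {ε : ℝ} (hε : 0 < ε) :
    ∃ g : Lp ℂ 1 μ, ‖g‖ ≤ 1 ∧ ‖odot μ (lucToDual μ f) g - f‖ ≤ ε := by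
  obtain ⟨U, hU, hUo, h1U⟩ := mem_nhds_iff.1 (f.2 ε hε)
  obtain ⟨k, k1, k0, k_supp, k01⟩ := exists_continuous_one_zero_of_isCompact
    (isCompact_singleton (x := (1 : G))) hUo.isClosed_compl
    (Set.disjoint_compl_right_iff_subset.2 (Set.singleton_subset_iff.2 h1U))
  have hpos : 0 < ∫ t, k t ∂μ :=
    k.continuous.integral_pos_of_hasCompactSupport_nonneg_nonzero (x := 1) k_supp
      (fun t => (k01 t).1) (by rw [k1 rfl]; simp)
  set c := ∫ t, k t ∂μ with hc
  let u : G → ℝ := fun t => c⁻¹ * k t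
  have hu : Continuous u := by fun_prop
  have hus : HasCompactSupport u := HasCompactSupport.mul_left k_supp
  have hu0 (t : G) : 0 ≤ u t := mul_nonneg (inv_nonneg.2 hpos.le) (k01 t).1
  have hui : Integrable u μ := hu.integrable_of_hasCompactSupport hus
  have hu1 : ∫ t, u t ∂μ = 1 := by
    rw [integral_const_mul, ← hc, inv_mul_cancel₀ hpos.ne']
  have huL : MemLp (fun t => (u t : ℂ)) 1 μ :=
    memLp_one_iff_integrable.2 hui.ofReal
  refine ⟨huL.toLp _, ?_, LUC.norm_le hε.le fun x => ?_⟩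
  · rw [L1.norm_eq_integral_norm, ← hu1]
    refine (integral_congr_ae ?_).le
    filter_upwards [huL.coeFn_toLp] with t ht
    rw [ht, Complex.norm_real, Real.norm_of_nonneg (hu0 t)]
  · change ‖odot μ (lucToDual μ f) (huL.toLp _) x - f x‖ ≤ ε
    have hfx : Continuous fun t => f (t * x) :=
      (f : G →ᵇ ℂ).continuous.comp (continuous_mul_const x)
    have e1 : ∫ t, huL.toLp _ t • f (t * x) ∂μ = ∫ t, (u t : ℂ) * f (t * x) ∂μ := by
      refine integral_congr_ae ?_
      filter_upwards [huL.coeFn_toLp] with t ht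
      rw [ht, smul_eq_mul]
    have e2 : f x = ∫ t, (u t : ℂ) * f x ∂μ := by
      rw [integral_mul_const, integral_complex_ofReal, hu1, Complex.ofReal_one, one_mul]
    have i1 : Integrable (fun t => (u t : ℂ) * f (t * x)) μ :=
      ((Complex.continuous_ofReal.comp hu).mul hfx).integrable_of_hasCompactSupport
        (HasCompactSupport.mul_right (hus.comp_left (g := fun r : ℝ => (r : ℂ)) (by simp)))
    have i2 : Integrable (fun t => (u t : ℂ) * f x) μ := hui.ofReal.mul_const _
    rw [odot_lucToDual_apply, e1, e2, ← integral_sub i1 i2]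
    calc _ ≤ ∫ t, ε * u t ∂μ := by
          refine norm_integral_le_of_norm_le (hui.const_mul ε) (Eventually.of_forall fun t => ?_)
          rw [← mul_sub, norm_mul, Complex.norm_real, Real.norm_of_nonneg (hu0 t), mul_comm]
          by_cases ht : t ∈ U
          · gcongr
            · exact hu0 t
            · exact hU ht x
          · have : u t = 0 := by simp [u, k0 ht]
            simp [this]
      _ = ε := by rw [integral_const_mul, hu1, mul_one]

/-- The bound `‖m‖ ≤ ‖φ(m)‖` holds because every `f ∈ LUC(G)` is a uniform limit of functions
`f ⊙ g` with `‖g‖ ≤ 1`. -/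
theorem norm_phi (m : StrongDual ℂ (LUC G)) : ‖phi μ m‖ = ‖m‖ := by
  refine le_antisymm (LinearMap.mkContinuous_norm_le _ (ContinuousLinearMap.opNorm_nonneg m) _)
    (m.opNorm_le_bound (ContinuousLinearMap.opNorm_nonneg _) fun f => ?_)
  refine le_of_forall_pos_le_add fun ε hε => ?_
  obtain ⟨g, hg, hgf⟩ := exists_norm_odot_sub_le μ f (ε := ε / (‖m‖ + 1)) (by positivity)
  have h1 : ‖m (odot μ (lucToDual μ f) g)‖ ≤ ‖phi μ m‖ * ‖f‖ := by
    change ‖phi μ m (lucToDual μ f) g‖ ≤ _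
    calc _ ≤ ‖phi μ m (lucToDual μ f)‖ * ‖g‖ := ContinuousLinearMap.le_opNorm _ _
      _ ≤ ‖phi μ m (lucToDual μ f)‖ * 1 := by gcongr
      _ ≤ ‖phi μ m‖ * ‖lucToDual μ f‖ := by
        rw [mul_one]; exact ContinuousLinearMap.le_opNorm _ _
      _ ≤ _ := by gcongr; exact norm_lucToDual_le μ f
  have h2 : ‖m (odot μ (lucToDual μ f) g - f)‖ ≤ ε :=
    calc _ ≤ ‖m‖ * (ε / (‖m‖ + 1)) := (m.le_opNorm _).trans (by gcongr)
      _ ≤ (‖m‖ + 1) * (ε / (‖m‖ + 1)) := by gcongr; linarith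
      _ = ε := by field_simp
  rw [map_sub] at h2
  linarith [norm_sub_norm_le (m f) (m (odot μ (lucToDual μ f) g)),
    norm_sub_rev (m f) (m (odot μ (lucToDual μ f) g))]

end Representation

/-! ### The Riesz representation theorem for bounded real functionals -/

section Riesz

open scoped CompactlySupported
open CompactlySupportedContinuousMap

variable {X : Type*} [TopologicalSpace X]

/-- The positive part of a real functional `Λ` on `C_c(X)`, on nonnegative functions:
`Λ⁺ f = sup {Λ g | 0 ≤ g ≤ f}`. This is the junk value `0` where the
set is not bounded above. -/
def posPartFun (Λ : C_c(X, ℝ) →ₗ[ℝ] ℝ) (f : C_c(X, ℝ≥0)) : ℝ :=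
  sSup ((fun g : C_c(X, ℝ≥0) => Λ g.toReal) '' Set.Iic f)

variable {Λ : C_c(X, ℝ) →ₗ[ℝ] ℝ} {C : ℝ≥0}

theorem exists_nnreal_bound (f : C_c(X, ℝ≥0)) : ∃ r : ℝ≥0, ∀ x, f x ≤ r := by
  obtain ⟨r, hr⟩ := (f.hasCompactSupport.isCompact_range f.continuous).bddAbove
  exact ⟨r, fun x => hr ⟨x, rfl⟩⟩

theorem bddAbove_posPartFun (hΛ : ∀ (f : C_c(X, ℝ≥0)) (r : ℝ≥0), (∀ x, f x ≤ r) →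
    |Λ f.toReal| ≤ C * r) (f : C_c(X, ℝ≥0)) :
    BddAbove ((fun g : C_c(X, ℝ≥0) => Λ g.toReal) '' Set.Iic f) := by
  obtain ⟨r, hr⟩ := exists_nnreal_bound f
  refine ⟨C * r, ?_⟩
  rintro _ ⟨g, hg, rfl⟩
  exact (le_abs_self _).trans (hΛ g r fun x => (le_def.1 hg x).trans (hr x))

theorem nonempty_posPartFun (f : C_c(X, ℝ≥0)) :
    ((fun g : C_c(X, ℝ≥0) => Λ g.toReal) '' Set.Iic f).Nonempty :=
  ⟨_, f, Set.mem_Iic.2 le_rfl, rfl⟩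

theorem le_posPartFun (hΛ : ∀ (f : C_c(X, ℝ≥0)) (r : ℝ≥0), (∀ x, f x ≤ r) →
    |Λ f.toReal| ≤ C * r) {f g : C_c(X, ℝ≥0)} (h : g ≤ f) : Λ g.toReal ≤ posPartFun Λ f :=
  le_csSup (bddAbove_posPartFun hΛ f) ⟨g, h, rfl⟩

theorem posPartFun_le {f : C_c(X, ℝ≥0)} {a : ℝ} (h : ∀ g ≤ f, Λ g.toReal ≤ a) :
    posPartFun Λ f ≤ a := by
  refine csSup_le (nonempty_posPartFun f) ?_
  rintro _ ⟨g, hg, rfl⟩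
  exact h g hg

theorem posPartFun_nonneg (hΛ : ∀ (f : C_c(X, ℝ≥0)) (r : ℝ≥0), (∀ x, f x ≤ r) →
    |Λ f.toReal| ≤ C * r) (f : C_c(X, ℝ≥0)) : 0 ≤ posPartFun Λ f := by
  have h0 : (0 : C_c(X, ℝ≥0)) ≤ f := le_def.2 fun x => by simp
  have : (0 : C_c(X, ℝ≥0)).toReal = 0 := by ext; simp
  simpa [this] using le_posPartFun hΛ h0

theorem posPartFun_add (hΛ : ∀ (f : C_c(X, ℝ≥0)) (r : ℝ≥0), (∀ x, f x ≤ r) →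
    |Λ f.toReal| ≤ C * r) (f₁ f₂ : C_c(X, ℝ≥0)) :
    posPartFun Λ (f₁ + f₂) = posPartFun Λ f₁ + posPartFun Λ f₂ := by
  refine le_antisymm (posPartFun_le fun g hg => ?_) ?_
  -- Riesz decomposition: `g ≤ f₁ + f₂` is the sum of `g ⊓ f₁ ≤ f₁` and a remainder `k ≤ f₂`.
  · obtain ⟨k, hk⟩ := CompactlySupportedContinuousMap.exists_add_of_le (inf_le_left : g ⊓ f₁ ≤ g)
    have hk2 : k ≤ f₂ := le_def.2 fun x => by
      have h1 : min (g x) (f₁ x) + k x = g x := by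
        simpa using DFunLike.congr_fun hk x
      have h2 : g x ≤ f₁ x + f₂ x := le_def.1 hg x
      rcases le_total (g x) (f₁ x) with h | h
      · rw [min_eq_left h] at h1
        have : k x = 0 := by simpa using h1
        simp [this]
      · rw [min_eq_right h] at h1
        rw [← h1] at h2
        exact le_of_add_le_add_left h2
    rw [← hk, toReal_add, map_add]
    exact add_le_add (le_posPartFun hΛ inf_le_right) (le_posPartFun hΛ hk2)
  · rw [← le_sub_iff_add_le]
    refine posPartFun_le fun g₁ h₁ => ?_
    rw [le_sub_comm]
    refine posPartFun_le fun g₂ h₂ => ?_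
    rw [le_sub_iff_add_le, add_comm, ← map_add, ← toReal_add]
    exact le_posPartFun hΛ (le_def.2 fun x => add_le_add (le_def.1 h₁ x) (le_def.1 h₂ x))

theorem posPartFun_smul (hΛ : ∀ (f : C_c(X, ℝ≥0)) (r : ℝ≥0), (∀ x, f x ≤ r) →
    |Λ f.toReal| ≤ C * r) (c : ℝ≥0) (f : C_c(X, ℝ≥0)) :
    posPartFun Λ (c • f) = c * posPartFun Λ f := by
  -- The inequality for `c⁻¹` and `c • f` is the reverse of the one for `c` and `f`.
  have key (c : ℝ≥0) (hc : c ≠ 0) (f : C_c(X, ℝ≥0)) :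
      posPartFun Λ (c • f) ≤ c * posPartFun Λ f := by
    refine posPartFun_le fun g hg => ?_
    have hg' : c⁻¹ • g ≤ f := le_def.2 fun x => by
      have := le_def.1 hg x
      simp only [CompactlySupportedContinuousMap.smul_apply, smul_eq_mul] at this ⊢
      rwa [inv_mul_le_iff₀ (pos_iff_ne_zero.2 hc)]
    have h := le_posPartFun hΛ hg'
    have e : (c⁻¹ • g).toReal = ((c : ℝ)⁻¹) • g.toReal := by
      ext x; simp [NNReal.smul_def]
    rw [e, map_smul, smul_eq_mul, inv_mul_le_iff₀ (by positivity)] at h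
    exact h
  rcases eq_or_ne c 0 with rfl | hc
  · rw [zero_smul, NNReal.coe_zero, zero_mul]
    have h := posPartFun_add hΛ 0 0
    rw [add_zero] at h
    linarith
  · refine le_antisymm (key c hc f) ?_
    have h := key c⁻¹ (inv_ne_zero hc) (c • f)
    rw [smul_smul, inv_mul_cancel₀ hc, one_smul, NNReal.coe_inv] at h
    rwa [← le_inv_mul_iff₀ (by positivity)]

/-- Jordan decomposition: a bounded real functional on `C_c(X)` is a difference of two bounded
positive functionals, `Λ = Λ⁺ - (Λ⁺ - Λ)`. -/
theorem exists_posPart_negPart (hΛ : ∀ (f : C_c(X, ℝ≥0)) (r : ℝ≥0), (∀ x, f x ≤ r) →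
    |Λ f.toReal| ≤ C * r) :
    ∃ P N : C_c(X, ℝ≥0) →ₗ[ℝ≥0] ℝ≥0, (∀ f, Λ f.toReal = P f - N f) ∧
      (∀ f, (∀ x, f x ≤ 1) → P f ≤ C) ∧ ∀ f, (∀ x, f x ≤ 1) → N f ≤ C + C := by
  let P : C_c(X, ℝ≥0) →ₗ[ℝ≥0] ℝ≥0 :=
    { toFun := fun f => ⟨posPartFun Λ f, posPartFun_nonneg hΛ f⟩
      map_add' := fun f g => NNReal.eq (posPartFun_add hΛ f g)
      map_smul' := fun c f => NNReal.eq (posPartFun_smul hΛ c f) }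
  let N : C_c(X, ℝ≥0) →ₗ[ℝ≥0] ℝ≥0 :=
    { toFun := fun f => ⟨posPartFun Λ f - Λ f.toReal, sub_nonneg.2 (le_posPartFun hΛ le_rfl)⟩
      map_add' := fun f g => NNReal.eq (by
        change posPartFun Λ (f + g) - Λ (f + g).toReal =
          (posPartFun Λ f - Λ f.toReal) + (posPartFun Λ g - Λ g.toReal)
        rw [posPartFun_add hΛ, toReal_add, map_add]
        ring)
      map_smul' := fun c f => NNReal.eq (by
        change posPartFun Λ (c • f) - Λ (c • f).toReal = c * (posPartFun Λ f - Λ f.toReal)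
        rw [posPartFun_smul hΛ, toReal_smul, NNReal.smul_def, map_smul, smul_eq_mul]
        ring) }
  have hP (f : C_c(X, ℝ≥0)) (hf : ∀ x, f x ≤ 1) : posPartFun Λ f ≤ C :=
    posPartFun_le fun g hg => (le_abs_self _).trans
      (by simpa using hΛ g 1 fun x => (le_def.1 hg x).trans (hf x))
  refine ⟨P, N, fun f => ?_, fun f hf => NNReal.coe_le_coe.1 (hP f hf), fun f hf =>
    NNReal.coe_le_coe.1 ?_⟩
  · change _ = posPartFun Λ f - (posPartFun Λ f - Λ f.toReal)
    ring
  · change posPartFun Λ f - Λ f.toReal ≤ ((C + C : ℝ≥0) : ℝ)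
    have := (neg_le_abs _).trans (hΛ f 1 hf)
    push_cast at this ⊢
    linarith [hP f hf]

variable [T2Space X] [LocallyCompactSpace X] [MeasurableSpace X] [BorelSpace X]

theorem isFiniteMeasure_rieszMeasure (P : C_c(X, ℝ≥0) →ₗ[ℝ≥0] ℝ≥0)
    (hP : ∀ f, (∀ x, f x ≤ 1) → P f ≤ C) : IsFiniteMeasure (NNRealRMK.rieszMeasure P) := by
  refine ⟨lt_of_le_of_lt ?_ (ENNReal.coe_lt_top (r := C))⟩
  rw [isOpen_univ.measure_eq_iSup_isCompact]
  refine iSup₂_le fun K _ => iSup_le fun hK => ?_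
  obtain ⟨k, k1, -, k_supp, k01⟩ := exists_continuous_one_zero_of_isCompact hK isClosed_empty
    (Set.disjoint_empty K)
  let f : C_c(X, ℝ≥0) := nnrealPart ⟨k, k_supp⟩
  have hf (x : X) : f x = (k x).toNNReal := rfl
  calc NNRealRMK.rieszMeasure P K = ∫⁻ _ in K, 1 ∂(NNRealRMK.rieszMeasure P) := by simp
    _ ≤ ∫⁻ x in K, f x ∂(NNRealRMK.rieszMeasure P) :=
        setLIntegral_mono' hK.measurableSet fun x hx => by simp [hf, k1 hx]
    _ ≤ ∫⁻ x, f x ∂(NNRealRMK.rieszMeasure P) := setLIntegral_le_lintegral _ _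
    _ = P f := NNRealRMK.lintegral_rieszMeasure P f
    _ ≤ C := by
      refine ENNReal.coe_le_coe.2 (hP f fun x => ?_)
      rw [hf, Real.toNNReal_le_one]
      exact (k01 x).2

/-- The Riesz representation theorem for bounded real functionals on `C_c(X)`. -/
theorem exists_finite_regular_of_bounded (Λ : C_c(X, ℝ) →ₗ[ℝ] ℝ) (C : ℝ≥0)
    (hΛ : ∀ (f : C_c(X, ℝ)) (r : ℝ≥0), (∀ x, |f x| ≤ r) → |Λ f| ≤ C * r) :
    ∃ ρ₁ ρ₂ : Measure X, IsFiniteMeasure ρ₁ ∧ IsFiniteMeasure ρ₂ ∧ ρ₁.Regular ∧ ρ₂.Regular ∧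
      ∀ f : C_c(X, ℝ), Λ f = ∫ x, f x ∂ρ₁ - ∫ x, f x ∂ρ₂ := by
  obtain ⟨P, N, h, hP, hN⟩ := exists_posPart_negPart (Λ := Λ) (C := C) fun f r hf =>
    hΛ f.toReal r fun x => by simpa using hf x
  have fP := isFiniteMeasure_rieszMeasure P hP
  have fN := isFiniteMeasure_rieszMeasure N hN
  refine ⟨NNRealRMK.rieszMeasure P, NNRealRMK.rieszMeasure N, fP, fN, inferInstance,
    inferInstance, fun f => ?_⟩
  have hi (ρ : Measure X) [IsFiniteMeasure ρ] (g : C_c(X, ℝ≥0)) :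
      Integrable (fun x => (g x : ℝ)) ρ :=
    (NNReal.continuous_coe.comp g.continuous).integrable_of_hasCompactSupport
      (g.hasCompactSupport.comp_left rfl)
  have hsplit (ρ : Measure X) [IsFiniteMeasure ρ] :
      ∫ x, f x ∂ρ = ∫ x, (f.nnrealPart x : ℝ) ∂ρ - ∫ x, ((-f).nnrealPart x : ℝ) ∂ρ := by
    rw [← integral_sub (hi ρ _) (hi ρ _)]
    congr 1
    funext x
    simp
  rw [hsplit, hsplit, NNRealRMK.integral_rieszMeasure, NNRealRMK.integral_rieszMeasure,
    NNRealRMK.integral_rieszMeasure, NNRealRMK.integral_rieszMeasure]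
  conv_lhs => rw [← nnrealPart_sub_nnrealPart_neg f, map_sub, h, h]
  ring

end Riesz

/-! ### Integrals against vector measures -/

section VectorIntegral

variable {X E F H E' F' H' : Type*} [MeasurableSpace X]
  [NormedAddCommGroup E] [NormedSpace ℝ E] [NormedAddCommGroup F] [NormedSpace ℝ F]
  [NormedAddCommGroup H] [NormedSpace ℝ H] [NormedAddCommGroup E'] [NormedSpace ℝ E']
  [NormedAddCommGroup F'] [NormedSpace ℝ F'] [NormedAddCommGroup H'] [NormedSpace ℝ H']

/-- The image of a vector measure under a continuous linear map. -/
def mapCLM (ν : VectorMeasure X F) (M : F →L[ℝ] F') : VectorMeasure X F' :=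
  ν.mapRange M.toLinearMap.toAddMonoidHom M.continuous

theorem mapCLM_apply (ν : VectorMeasure X F) (M : F →L[ℝ] F') (s : Set X) :
    mapCLM ν M s = M (ν s) := rfl

theorem variation_mapCLM_le (ν : VectorMeasure X F) (M : F →L[ℝ] F') :
    (mapCLM ν M).variation ≤ ‖M‖₊ • ν.variation := by
  refine VectorMeasure.variation_le_of_forall_enorm_le fun s _ => ?_
  rw [mapCLM_apply, Measure.smul_apply]
  refine (M.le_opENorm _).trans ?_
  rw [ENNReal.smul_def, smul_eq_mul, ← enorm_eq_nnnorm]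
  gcongr
  exact VectorMeasure.enorm_measure_le_variation ν s

theorem integral_indicator_const_vector [CompleteSpace H] (ν : VectorMeasure X F)
    [IsFiniteMeasure ν.variation] (B : E →L[ℝ] F →L[ℝ] H) (c : E) {s : Set X}
    (hs : MeasurableSet s) : ν.integral (s.indicator fun _ => c) B = B c (ν s) := by
  have : IsFiniteMeasure (ν.restrict s).variation := by
    rw [VectorMeasure.variation_restrict hs]; infer_instance
  have h := VectorMeasure.integral_indicator (μ := ν) (f := fun _ : X => c) (B := B) hs
  rw [VectorMeasure.integral_const, VectorMeasure.restrict_apply _ hs MeasurableSet.univ,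
    Set.univ_inter] at h
  exact h

/-- Continuous linear maps commute with the integral against a vector measure, as long as they are
compatible with the pairings. It is enough to check this on indicator functions. -/
theorem map_integral_vector [CompleteSpace H] [CompleteSpace H'] (ν : VectorMeasure X F)
    [IsFiniteMeasure ν.variation]
    (B : E →L[ℝ] F →L[ℝ] H) (B' : E' →L[ℝ] F' →L[ℝ] H')
    (L : H →L[ℝ] H') (A : E →L[ℝ] E') (M : F →L[ℝ] F')
    (hBB' : ∀ x y, L (B x y) = B' (A x) (M y)) {f : X → E} (hf : ν.Integrable f) :
    L (ν.integral f B) = (mapCLM ν M).integral (fun x => A (f x)) B' := by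
  have hfin : IsFiniteMeasure (mapCLM ν M).variation :=
    isFiniteMeasure_of_le _ (variation_mapCLM_le ν M)
  have hA {f : X → E} (hf : Integrable f ν.variation) :
      Integrable (fun x => A (f x)) (mapCLM ν M).variation :=
    A.integrable_comp ((Integrable.smul_measure_nnreal hf).mono_measure (variation_mapCLM_le ν M))
  refine Integrable.induction (fun f => L (ν.integral f B) =
    (mapCLM ν M).integral (fun x => A (f x)) B') ?_ ?_ ?_ ?_ hf
  · intro c s hs _
    have : (fun x => A (s.indicator (fun _ => c) x)) = s.indicator fun _ => A c := by
      funext x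
      by_cases hx : x ∈ s <;> simp [hx]
    rw [this, integral_indicator_const_vector ν B c hs,
      integral_indicator_const_vector _ B' (A c) hs, hBB', mapCLM_apply]
  · intro f g _ hf hg h1 h2
    have e1 := VectorMeasure.integral_add (B := B) hf hg
    have e2 := VectorMeasure.integral_fun_add (B := B') (hA hf) (hA hg)
    change L (ν.integral (fun x => (f + g) x) B) = _
    rw [e1, map_add, h1, h2, ← e2]
    simp only [Pi.add_apply, map_add]
  · refine isClosed_eq (L.continuous.comp VectorMeasure.continuous_integral) ?_
    refine (LipschitzWith.of_dist_le_mul (K := ‖B'‖₊ * (‖M‖₊ * ‖A‖₊)) fun f g => ?_).continuous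
    have hf := L1.integrable_coeFn f
    have hg := L1.integrable_coeFn g
    rw [dist_eq_norm, dist_eq_norm, ← VectorMeasure.integral_fun_sub (hA hf) (hA hg),
      L1.norm_eq_integral_norm]
    refine VectorMeasure.norm_integral_le_integral_norm.trans ?_
    have hsub : Integrable (fun x => ‖f x - g x‖) ν.variation := (hf.sub hg).norm
    have e : ∫ x, ‖(f - g : X →₁[ν.variation] E) x‖ ∂ν.variation =
        ∫ x, ‖f x - g x‖ ∂ν.variation := by
      refine integral_congr_ae ?_
      filter_upwards [Lp.coeFn_sub f g] with x hx
      rw [hx, Pi.sub_apply]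
    rw [e]
    calc ‖B'‖ * ∫ x, ‖A (f x) - A (g x)‖ ∂(mapCLM ν M).variation
        ≤ ‖B'‖ * ∫ x, ‖A‖ * ‖f x - g x‖ ∂(‖M‖₊ • ν.variation) := by
          gcongr
          have hi : Integrable (fun x => ‖A‖ * ‖f x - g x‖) (‖M‖₊ • ν.variation) :=
            (hsub.const_mul _).smul_measure_nnreal
          refine (integral_mono (((hA hf).sub (hA hg)).norm)
            (hi.mono_measure (variation_mapCLM_le ν M)) fun x => ?_).trans
            (integral_mono_measure (variation_mapCLM_le ν M)
              (Eventually.of_forall fun x => by positivity) hi)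
          simp only [Pi.sub_apply, ← map_sub]
          exact A.le_opNorm _
      _ = _ := by
          rw [integral_smul_nnreal_measure, integral_const_mul, NNReal.smul_def, smul_eq_mul]
          push_cast
          ring
  · intro f g hfg hf h
    rw [← VectorMeasure.integral_congr_ae hfg, h]
    refine VectorMeasure.integral_congr_ae ?_
    have : (mapCLM ν M).variation ≪ ν.variation :=
      Measure.absolutelyContinuous_of_le_smul (variation_mapCLM_le ν M)
    filter_upwards [this.ae_le hfg] with x hx
    rw [hx]

/-- The complex measure `c ρ`, for a finite measure `ρ`. -/
def smulMeasure (c : ℂ) (ρ : Measure X) [IsFiniteMeasure ρ] : ComplexMeasure X :=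
  mapCLM ρ.toSignedMeasure (ContinuousLinearMap.toSpanSingleton ℝ c)

theorem variation_smulMeasure_le (c : ℂ) (ρ : Measure X) [IsFiniteMeasure ρ] :
    (smulMeasure c ρ).variation ≤ ‖c‖₊ • ρ := by
  refine (variation_mapCLM_le _ _).trans_eq ?_
  rw [Measure.variation_toSignedMeasure]
  congr 1
  exact NNReal.eq (ContinuousLinearMap.norm_toSpanSingleton c)

theorem integral_smulMeasure (c : ℂ) (ρ : Measure X) [IsFiniteMeasure ρ] {f : X → ℂ}
    (hf : Integrable f ρ) :
    (smulMeasure c ρ).integral f (ContinuousLinearMap.mul ℝ ℂ) = c * ∫ x, f x ∂ρ := by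
  have hv := Measure.variation_toSignedMeasure (μ := ρ)
  have : IsFiniteMeasure ρ.toSignedMeasure.variation := by rw [hv]; infer_instance
  have h := map_integral_vector ρ.toSignedMeasure (ContinuousLinearMap.lsmul ℝ ℝ (E := ℂ)).flip
    (ContinuousLinearMap.mul ℝ ℂ) (ContinuousLinearMap.mul ℝ ℂ c) (ContinuousLinearMap.id ℝ ℂ)
    (ContinuousLinearMap.toSpanSingleton ℝ c)
    (fun x y => by simp; ring) (f := f) (by rw [VectorMeasure.Integrable, hv]; exact hf)
  rw [VectorMeasure.integral_toSignedMeasure] at h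
  exact h.symm

end VectorIntegral

/-! ### Finite regular measures -/

section Regularity

variable {X : Type*} [TopologicalSpace X] [T2Space X] [MeasurableSpace X] [BorelSpace X]

/-- Inner regularity by compact sets passes from a finite measure `ρ` to every `η ≤ ρ`, since
`η (A \ K) ≤ ρ (A \ K)`, and for finite measures it implies outer regularity. -/
theorem regular_of_le {η ρ : Measure X} [IsFiniteMeasure ρ] [ρ.Regular] (h : η ≤ ρ) :
    η.Regular := by
  have : IsFiniteMeasure η := isFiniteMeasure_of_le ρ h
  have : η.InnerRegularCompactLTTop := by
    refine ⟨fun A hA r hr => ?_⟩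
    obtain ⟨K, hKA, hK, hlt⟩ := hA.1.exists_isCompact_sdiff_lt (μ := ρ) (measure_ne_top ρ A)
      (tsub_pos_of_lt hr).ne'
    refine ⟨K, hKA, hK, ?_⟩
    by_contra! hle
    have h1 : η A ≤ η K + η (A \ K) := by
      refine (measure_mono ?_).trans (measure_union_le _ _)
      rw [Set.union_sdiff_self]
      exact Set.subset_union_right
    have h2 : η (A \ K) < η A - r := (h _).trans_lt hlt
    have h3 : η A < r + (η A - r) :=
      h1.trans_lt (ENNReal.add_lt_add_of_le_of_lt (measure_ne_top η K) hle h2)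
    rw [add_tsub_cancel_of_le hr.le] at h3
    exact h3.false
  infer_instance

/-- A regular finite measure is carried by a `σ`-compact set, so continuity implies strong
measurability even when the space is not second countable. -/
theorem aestronglyMeasurable_of_continuous {E : Type*} [TopologicalSpace E]
    [TopologicalSpace.PseudoMetrizableSpace E] {u : X → E} (hu : Continuous u) (ρ : Measure X)
    [IsFiniteMeasure ρ] [ρ.Regular] : AEStronglyMeasurable u ρ := by
  have hK (n : ℕ) : ∃ K : Set X, IsCompact K ∧ ρ Kᶜ < ((n : ℝ≥0∞) + 1)⁻¹ := by
    obtain ⟨K, -, hK, hlt⟩ := MeasurableSet.univ.exists_isCompact_sdiff_lt (μ := ρ)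
      (measure_ne_top ρ _) (ε := ((n : ℝ≥0∞) + 1)⁻¹) (by simp)
    exact ⟨K, hK, by rwa [Set.compl_eq_univ_sdiff]⟩
  choose K hKc hKlt using hK
  have h0 : ρ (⋃ n, K n)ᶜ = 0 := by
    refine le_antisymm (ENNReal.le_of_forall_pos_le_add fun ε hε _ => ?_) zero_le
    obtain ⟨n, hn⟩ := ENNReal.exists_inv_nat_lt (ENNReal.coe_pos.2 hε).ne'
    rw [zero_add]
    calc _ ≤ ρ (K n)ᶜ := measure_mono (Set.compl_subset_compl.2 (Set.subset_iUnion K n))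
      _ ≤ ((n : ℝ≥0∞) + 1)⁻¹ := (hKlt n).le
      _ ≤ (n : ℝ≥0∞)⁻¹ := ENNReal.inv_le_inv.2 le_self_add
      _ ≤ ε := hn.le
  have h1 : ρ.restrict (⋃ n, K n) = ρ := Measure.restrict_eq_self_of_ae_mem (by
    rw [ae_iff]; exact h0)
  rw [← h1, aestronglyMeasurable_iUnion_iff]
  exact fun n => hu.continuousOn.aestronglyMeasurable_of_isCompact (hKc n) (hKc n).measurableSet

end Regularity

/-! ### Measures as functionals on `LUC(G)` -/

section MeasureFunctional

open scoped CompactlySupported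

variable {G : Type*} [Group G] [TopologicalSpace G]

theorem integrable_luc [MeasurableSpace G] [BorelSpace G] (ν : ComplexMeasure G)
    [IsFiniteMeasure ν.variation] (f : LUC G) : ν.Integrable f :=
  Integrable.of_bound (f : G →ᵇ ℂ).continuous.aestronglyMeasurable ‖f‖
    (Eventually.of_forall (LUC.norm_apply_le f))

/-- The functional `f ↦ ∫ f dν` on `LUC(G)`. -/
def measureFunctional [MeasurableSpace G] [BorelSpace G] (ν : ComplexMeasure G)
    [IsFiniteMeasure ν.variation] : StrongDual ℂ (LUC G) :=
  LinearMap.mkContinuous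
    { toFun := fun f => ν.integral f (ContinuousLinearMap.mul ℝ ℂ)
      map_add' := fun f g =>
        VectorMeasure.integral_fun_add (integrable_luc ν f) (integrable_luc ν g)
      map_smul' := fun c f => by
        have h := map_integral_vector ν (ContinuousLinearMap.mul ℝ ℂ)
          (ContinuousLinearMap.mul ℝ ℂ) (ContinuousLinearMap.mul ℝ ℂ c)
          (ContinuousLinearMap.mul ℝ ℂ c) (ContinuousLinearMap.id ℝ ℂ)
          (fun x y => by simp [mul_assoc]) (integrable_luc ν f)
        exact h.symm }
    (‖ContinuousLinearMap.mul ℝ ℂ‖ * ν.variation.real Set.univ)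
    (fun f => by
      refine (VectorMeasure.norm_integral_le_of_norm_le_const
        (Eventually.of_forall (LUC.norm_apply_le f))).trans_eq ?_
      ring)

theorem measureFunctional_apply [MeasurableSpace G] [BorelSpace G] (ν : ComplexMeasure G)
    [IsFiniteMeasure ν.variation] (f : LUC G) :
    measureFunctional ν f = ν.integral f (ContinuousLinearMap.mul ℝ ℂ) := rfl

variable [IsTopologicalGroup G]

/-- Continuous functions with compact support belong to `LUC(G)`. -/
theorem left_uniform_of_hasCompactSupport {f : G → ℂ} (hf : Continuous f)
    (hs : HasCompactSupport f) : ∀ ε > 0, ∀ᶠ x in 𝓝 (1 : G), ∀ y, ‖f (x * y) - f y‖ ≤ ε := by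
  intro ε hε
  -- The entourages of the right uniformity are given by the condition that `x y⁻¹` is near `1`.
  let _ := IsTopologicalGroup.rightUniformSpace G
  have h := hs.uniformContinuous_of_continuous hf (Metric.dist_mem_uniformity hε)
  obtain ⟨U, hU, hUs⟩ := mem_comap.1 h
  filter_upwards [hU] with x hx y
  have : dist (f y) (f (x * y)) < ε := @hUs (y, x * y) (by simpa using hx)
  rw [← dist_eq_norm, dist_comm]
  exact this.le

/-- A real function in `C_c(G)`, as an element of `LUC(G)`. -/
def lucOfCompactSupport (f : C_c(G, ℝ)) : LUC G :=
  LUC.mk (fun x => (f x : ℂ))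
    (f.hasCompactSupport.exists_bound_of_continuous f.continuous).choose
    (fun x => by
      rw [Complex.norm_real]
      exact (f.hasCompactSupport.exists_bound_of_continuous f.continuous).choose_spec x)
    (left_uniform_of_hasCompactSupport (Complex.continuous_ofReal.comp f.continuous)
      (f.hasCompactSupport.comp_left (g := fun r : ℝ => (r : ℂ)) (by simp)))

@[simp] theorem lucOfCompactSupport_apply (f : C_c(G, ℝ)) (x : G) :
    lucOfCompactSupport f x = (f x : ℂ) := rfl

/-- The real functional on `C_c(G, ℝ)` given by the composition of `m ∈ LUC(G)^*` with a real
functional on `ℂ`, such as the real part or the imaginary part. -/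
def realFunctional (m : StrongDual ℂ (LUC G)) (p : ℂ →L[ℝ] ℝ) : C_c(G, ℝ) →ₗ[ℝ] ℝ where
  toFun f := p (m (lucOfCompactSupport f))
  map_add' f g := by
    rw [← map_add, ← map_add]
    congr 2
    refine LUC.ext fun x => ?_
    change ((f x + g x : ℝ) : ℂ) = (f x : ℂ) + g x
    push_cast; rfl
  map_smul' c f := by
    have : lucOfCompactSupport (c • f) = (c : ℂ) • lucOfCompactSupport f := LUC.ext fun x => by
      change ((c * f x : ℝ) : ℂ) = (c : ℂ) * f x
      push_cast; rfl
    rw [this, map_smul, Complex.coe_smul, map_smul]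
    rfl

/-- On `C_c(G, ℝ)`, the functional `f ↦ p(m(f))` is given by a difference of finite regular measures;
for `p` the real or the imaginary part, this is the Riesz representation of `Re m` and `Im m`. -/
theorem exists_measures_realFunctional [T2Space G] [LocallyCompactSpace G] [MeasurableSpace G]
    [BorelSpace G] (m : StrongDual ℂ (LUC G)) (p : ℂ →L[ℝ] ℝ) :
    ∃ ρ₁ ρ₂ : Measure G, IsFiniteMeasure ρ₁ ∧ IsFiniteMeasure ρ₂ ∧ ρ₁.Regular ∧ ρ₂.Regular ∧
      ∀ f : C_c(G, ℝ), p (m (lucOfCompactSupport f)) = ∫ x, f x ∂ρ₁ - ∫ x, f x ∂ρ₂ := by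
  refine exists_finite_regular_of_bounded (realFunctional m p) (‖p‖₊ * ‖m‖₊) fun f r hf => ?_
  have h : ‖lucOfCompactSupport f‖ ≤ r :=
    LUC.norm_le r.2 fun x => by simpa using hf x
  change ‖p (m (lucOfCompactSupport f))‖ ≤ _
  push_cast
  rw [mul_assoc]
  refine (p.le_opNorm _).trans ?_
  gcongr
  refine (m.le_opNorm _).trans ?_
  gcongr

variable [T2Space G] [MeasurableSpace G] [BorelSpace G]

/-- The Riesz representation theorem, for the restriction of `m ∈ LUC(G)^*` to the functions with
compact support: the regular complex measure is assembled from the measures that represent the real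
and the imaginary part of `m`. -/
theorem exists_complexMeasure [LocallyCompactSpace G] (m : StrongDual ℂ (LUC G)) :
    ∃ ν : ComplexMeasure G, IsFiniteMeasure ν.variation ∧ ν.variation.Regular ∧
      ∀ f : LUC G, HasCompactSupport f → m f = ν.integral f (ContinuousLinearMap.mul ℝ ℂ) := by
  obtain ⟨ρ₁, ρ₂, _, _, _, _, hre⟩ := exists_measures_realFunctional m Complex.reCLM
  obtain ⟨ρ₃, ρ₄, _, _, _, _, him⟩ := exists_measures_realFunctional m Complex.imCLM
  have hle (c : ℂ) (hc : ‖c‖ = 1) (ρ : Measure G) [IsFiniteMeasure ρ] :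
      (smulMeasure c ρ).variation ≤ ρ := by
    have h := variation_smulMeasure_le c ρ
    rwa [show ‖c‖₊ = 1 from NNReal.eq hc, one_smul] at h
  set ν : ComplexMeasure G := smulMeasure 1 ρ₁ + smulMeasure (-1) ρ₂ +
    (smulMeasure Complex.I ρ₃ + smulMeasure (-Complex.I) ρ₄) with hν
  have hν_le : ν.variation ≤ ρ₁ + ρ₂ + (ρ₃ + ρ₄) := by
    refine VectorMeasure.variation_add_le.trans (add_le_add
      (VectorMeasure.variation_add_le.trans (add_le_add ?_ ?_))
      (VectorMeasure.variation_add_le.trans (add_le_add ?_ ?_))) <;>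
    exact hle _ (by simp) _
  refine ⟨ν, isFiniteMeasure_of_le _ hν_le, regular_of_le hν_le, fun f hf => ?_⟩
  have fc : Continuous f := (f : G →ᵇ ℂ).continuous
  have hfin (c : ℂ) (ρ : Measure G) [IsFiniteMeasure ρ] :
      IsFiniteMeasure (smulMeasure c ρ).variation :=
    isFiniteMeasure_of_le _ (variation_smulMeasure_le c ρ)
  have fi (c : ℂ) (ρ : Measure G) [IsFiniteMeasure ρ] : (smulMeasure c ρ).Integrable f :=
    have := hfin c ρ
    integrable_luc _ f
  have fi' (ρ : Measure G) [IsFiniteMeasure ρ] : Integrable f ρ :=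
    Integrable.of_bound fc.aestronglyMeasurable ‖f‖ (Eventually.of_forall (LUC.norm_apply_le f))
  let a : C_c(G, ℝ) := ⟨⟨fun x => (f x).re, Complex.continuous_re.comp fc⟩,
    hf.comp_left (g := Complex.re) rfl⟩
  let b : C_c(G, ℝ) := ⟨⟨fun x => (f x).im, Complex.continuous_im.comp fc⟩,
    hf.comp_left (g := Complex.im) rfl⟩
  have hab : f = lucOfCompactSupport a + Complex.I • lucOfCompactSupport b := LUC.ext fun x => by
    change f x = ((f x).re : ℂ) + Complex.I * ((f x).im : ℂ)
    rw [mul_comm, Complex.re_add_im]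
  have hint (ρ : Measure G) [IsFiniteMeasure ρ] :
      ∫ x, f x ∂ρ = ((∫ x, a x ∂ρ : ℝ) : ℂ) + Complex.I * ((∫ x, b x ∂ρ : ℝ) : ℂ) := by
    have h := integral_re_add_im (fi' ρ)
    simp only [RCLike.re_to_complex, RCLike.im_to_complex, RCLike.I_to_complex] at h
    rw [← h, mul_comm Complex.I]
    rfl
  have hm (k : C_c(G, ℝ)) : m (lucOfCompactSupport k) =
      ((∫ x, k x ∂ρ₁ - ∫ x, k x ∂ρ₂ : ℝ) : ℂ) +
        ((∫ x, k x ∂ρ₃ - ∫ x, k x ∂ρ₄ : ℝ) : ℂ) * Complex.I := by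
    rw [← hre, ← him, Complex.reCLM_apply, Complex.imCLM_apply, Complex.re_add_im]
  rw [hν, VectorMeasure.integral_add_vectorMeasure ((fi _ _).add_vectorMeasure (fi _ _))
      ((fi _ _).add_vectorMeasure (fi _ _)),
    VectorMeasure.integral_add_vectorMeasure (fi _ _) (fi _ _),
    VectorMeasure.integral_add_vectorMeasure (fi _ _) (fi _ _),
    integral_smulMeasure _ _ (fi' _), integral_smulMeasure _ _ (fi' _),
    integral_smulMeasure _ _ (fi' _), integral_smulMeasure _ _ (fi' _), hint, hint, hint, hint]
  conv_lhs => rw [hab, map_add, map_smul, hm, hm, smul_eq_mul]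
  push_cast
  ring

end MeasureFunctional

/-! ### Truncation to compact sets -/

section Cutoff

variable {G : Type*} [TopologicalSpace G] [T2Space G] [MeasurableSpace G] [BorelSpace G]
  (μ : Measure G)

/-- Multiplication by the indicator function of `K`, as an operator on `L₁(G)`. -/
def cutoff (K : TopologicalSpace.Compacts G) : Lp ℂ 1 μ →L[ℂ] Lp ℂ 1 μ :=
  LinearMap.mkContinuous
    { toFun := fun f => ((Lp.memLp f).indicator K.isCompact.measurableSet).toLp _
      map_add' := fun f g => by
        rw [← MemLp.toLp_add]
        refine MemLp.toLp_congr _ _ ?_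
        filter_upwards [Lp.coeFn_add f g] with t ht
        by_cases htK : t ∈ (K : Set G)
        · simp only [Pi.add_apply, Set.indicator_of_mem htK, ht]
        · simp only [Pi.add_apply, Set.indicator_of_notMem htK, add_zero]
      map_smul' := fun c f => by
        rw [RingHom.id_apply, ← MemLp.toLp_const_smul]
        refine MemLp.toLp_congr _ _ ?_
        filter_upwards [Lp.coeFn_smul c f] with t ht
        by_cases htK : t ∈ (K : Set G)
        · simp only [Pi.smul_apply, Set.indicator_of_mem htK, ht]
        · simp only [Pi.smul_apply, Set.indicator_of_notMem htK, smul_zero] }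
    1 (fun f => by
      rw [one_mul]
      refine Lp.norm_le_norm_of_ae_le ?_
      filter_upwards [((Lp.memLp f).indicator K.isCompact.measurableSet).coeFn_toLp] with t ht
      refine (congrArg _ ht).trans_le ?_
      exact norm_indicator_le_norm_self _ _)

theorem coeFn_cutoff (K : TopologicalSpace.Compacts G) (f : Lp ℂ 1 μ) :
    cutoff μ K f =ᵐ[μ] (K : Set G).indicator f :=
  ((Lp.memLp f).indicator K.isCompact.measurableSet).coeFn_toLp

theorem norm_cutoff_apply_le (K : TopologicalSpace.Compacts G) (f : Lp ℂ 1 μ) :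
    ‖cutoff μ K f‖ ≤ ‖f‖ := by
  refine ((cutoff μ K).le_opNorm f).trans (mul_le_of_le_one_left (norm_nonneg _) ?_)
  exact LinearMap.mkContinuous_norm_le _ zero_le_one _

end Cutoff

/-! ### Normal operators in the range of the representation -/

section Normal

variable {G : Type*} [Group G] [TopologicalSpace G] [IsTopologicalGroup G] [LocallyCompactSpace G]
  [T2Space G] [MeasurableSpace G] [BorelSpace G] (μ : Measure G) [μ.IsHaarMeasure] [μ.Regular]

/-- The predual of `φ(ν)` maps `g` to `g * ν = ∫ (g * δ_x) dν(x)`, an integral in `L₁(G)`. -/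
theorem phi_measureFunctional_apply (ν : ComplexMeasure G) [IsFiniteMeasure ν.variation]
    [ν.variation.Regular] (h : StrongDual ℂ (Lp ℂ 1 μ)) (g : Lp ℂ 1 μ) :
    phi μ (measureFunctional ν) h g = h (ν.integral (fun x => convDirac μ g x)
      (ContinuousLinearMap.lsmul ℝ ℂ (E := Lp ℂ 1 μ)).flip) := by
  have hi : ν.Integrable fun x => convDirac μ g x :=
    Integrable.of_bound (aestronglyMeasurable_of_continuous (continuous_convDirac μ g) _) ‖g‖
      (Eventually.of_forall fun x => (norm_convDirac μ g x).le)
  have key := map_integral_vector ν (ContinuousLinearMap.lsmul ℝ ℂ (E := Lp ℂ 1 μ)).flip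
    (ContinuousLinearMap.mul ℝ ℂ) (h.restrictScalars ℝ) (h.restrictScalars ℝ)
    (ContinuousLinearMap.id ℝ ℂ) (fun x y => by simp [mul_comm]) hi
  exact key.symm

/-- `φ(ν)` is normal because it is the adjoint of the map `g ↦ g * ν` on `L₁(G)`. -/
theorem phi_measureFunctional_mem (ν : ComplexMeasure G) [IsFiniteMeasure ν.variation]
    [ν.variation.Regular] : phi μ (measureFunctional ν) ∈ normalOperators μ := by
  refine WeakDual.continuous_of_continuous_eval fun g => ?_
  change Continuous fun h : WeakDual ℂ (Lp ℂ 1 μ) =>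
    phi μ (measureFunctional ν) (WeakDual.toStrongDual h) g
  simp only [phi_measureFunctional_apply]
  exact WeakDual.eval_continuous _

/-- The truncations of `f ∈ L₁(G)` to compact sets, directed by inclusion, converge to `f`. -/
theorem tendsto_cutoff (f : Lp ℂ 1 μ) :
    Tendsto (fun K => cutoff μ K f) atTop (𝓝 f) := by
  rw [Metric.tendsto_nhds]
  intro ε hε
  obtain ⟨f', ⟨k, -, k_supp, hk⟩, hd⟩ :=
    Metric.mem_closure_iff.1 (dense_continuous_compactSupport μ f) (ε / 2) (half_pos hε)
  filter_upwards [eventually_ge_atTop (⟨tsupport k, k_supp.isCompact⟩ :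
    TopologicalSpace.Compacts G)] with K hK
  -- The truncation fixes `f'` as soon as `K` contains the support of `k`.
  have h1 : cutoff μ K f' = f' := by
    refine Lp.ext ?_
    filter_upwards [coeFn_cutoff μ K f', hk] with t h1 h2
    rw [h1]
    by_cases ht : t ∈ (K : Set G)
    · rw [Set.indicator_of_mem ht]
    · rw [Set.indicator_of_notMem ht, h2, image_eq_zero_of_notMem_tsupport fun h => ht (hK h)]
  calc dist (cutoff μ K f) f ≤ dist (cutoff μ K f) (cutoff μ K f') + dist f' f := by
        nth_rw 2 [← h1]
        have := dist_triangle (cutoff μ K f) (cutoff μ K f') f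
        rwa [h1] at this ⊢
    _ ≤ dist f f' + dist f f' := by
        rw [dist_comm f' f]
        gcongr
        rw [dist_eq_norm, dist_eq_norm, ← map_sub]
        exact norm_cutoff_apply_le μ K _
    _ < ε := by linarith

/-- If `g` has compact support, then so has `h ⊙ g` for every `h ∈ L_∞(G)` carried by a compact
set. -/
theorem hasCompactSupport_odot_cutoff (h : StrongDual ℂ (Lp ℂ 1 μ))
    (K : TopologicalSpace.Compacts G) {g : Lp ℂ 1 μ} {k : G → ℂ} (hk : HasCompactSupport k)
    (hg : g =ᵐ[μ] k) : HasCompactSupport (odot μ (h.comp (cutoff μ K)) g) := by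
  refine HasCompactSupport.intro (hk.isCompact.inv.mul K.isCompact) fun x hx => ?_
  have h0 : cutoff μ K (convDirac μ g x) = 0 := by
    refine Lp.ext ?_
    filter_upwards [coeFn_cutoff μ K (convDirac μ g x), coeFn_convDirac μ g x,
      ae_comp_mul_right μ hg x⁻¹, Lp.coeFn_zero ℂ 1 μ] with t h1 h2 h3 h4
    rw [h1, h4, Pi.zero_apply]
    by_cases ht : t ∈ (K : Set G)
    · rw [Set.indicator_of_mem ht, h2, h3, image_eq_zero_of_notMem_tsupport (f := k), mul_zero]
      intro h5
      exact hx ⟨(t * x⁻¹)⁻¹, Set.inv_mem_inv.2 h5, t, ht, by simp⟩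
    · rw [Set.indicator_of_notMem ht]
  rw [odot_apply, ContinuousLinearMap.comp_apply, h0, map_zero]

/-- If `φ(n)` is normal and `n` vanishes on the functions with compact support, then `n = 0`. -/
theorem eq_zero_of_phi_mem_normalOperators {n : StrongDual ℂ (LUC G)}
    (hn : phi μ n ∈ normalOperators μ) (h0 : ∀ f : LUC G, HasCompactSupport f → n f = 0) :
    n = 0 := by
  suffices hφ : phi μ n = 0 by
    have h : ‖n‖ = 0 := by rw [← norm_phi μ n, hφ, ContinuousLinearMap.opNorm_zero]
    exact ContinuousLinearMap.ext fun f =>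
      norm_le_zero_iff.1 ((n.le_opNorm f).trans_eq (by rw [h, zero_mul]))
  have hd (h : StrongDual ℂ (Lp ℂ 1 μ)) : ∀ g ∈ {f : Lp ℂ 1 μ | ∃ k : G → ℂ, Continuous k ∧
      HasCompactSupport k ∧ f =ᵐ[μ] k}, phi μ n h g = 0 := by
    rintro g ⟨k, -, hk, hg⟩
    -- The truncations `h 1_K` converge weak-* to `h`, and `φ(n)(h 1_K)` vanishes at `g`.
    have hlim : Tendsto (fun K => StrongDual.toWeakDual (h.comp (cutoff μ K))) atTop
        (𝓝 (StrongDual.toWeakDual h)) := by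
      refine tendsto_iff_forall_eval_tendsto_topDualPairing.2 fun f => ?_
      exact (h.continuous.tendsto f).comp (tendsto_cutoff μ f)
    have hc : Continuous fun h : WeakDual ℂ (Lp ℂ 1 μ) =>
        phi μ n (WeakDual.toStrongDual h) g := (WeakDual.eval_continuous g).comp hn
    refine tendsto_nhds_unique ((hc.tendsto _).comp hlim) ?_
    refine tendsto_const_nhds.congr fun K => ?_
    exact (h0 _ (hasCompactSupport_odot_cutoff μ h K hk hg)).symm
  ext h g
  exact congrFun (Continuous.ext_on (dense_continuous_compactSupport μ) (phi μ n h).continuous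
    continuous_const (hd h)) g

end Normal

end LUCDual

end

theorem proposition2p3 {G : Type*} [Group G] [TopologicalSpace G] [IsTopologicalGroup G]
    [LocallyCompactSpace G] [T2Space G] [MeasurableSpace G] [BorelSpace G]
    (μ : Measure G) [μ.IsHaarMeasure] [μ.Regular] :
    IsLinearMap ℂ (LUCDual.phi μ) ∧
    (∀ m n : StrongDual ℂ (LUCDual.LUC G),
      LUCDual.phi μ (LUCDual.lucMul m n) = (LUCDual.phi μ m).comp (LUCDual.phi μ n)) ∧
    LUCDual.phi μ LUCDual.lucOne = ContinuousLinearMap.id ℂ (StrongDual ℂ (Lp ℂ 1 μ)) ∧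
    (∀ m : StrongDual ℂ (LUCDual.LUC G), ‖LUCDual.phi μ m‖ = ‖m‖) ∧
    LUCDual.phi μ '' LUCDual.measureAlgebra =
      Set.range (LUCDual.phi μ) ∩ LUCDual.normalOperators μ := by
  refine ⟨LUCDual.isLinearMap_phi μ, LUCDual.phi_lucMul μ, LUCDual.phi_lucOne μ,
    LUCDual.norm_phi μ, Set.Subset.antisymm ?_ ?_⟩
  · rintro _ ⟨m, ⟨ν, _, _, hm⟩, rfl⟩
    obtain rfl : m = LUCDual.measureFunctional ν := ContinuousLinearMap.ext hm
    exact ⟨⟨_, rfl⟩, LUCDual.phi_measureFunctional_mem μ ν⟩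
  · rintro _ ⟨⟨m, rfl⟩, hm⟩
    obtain ⟨ν, _, _, hν⟩ := LUCDual.exists_complexMeasure m
    have hmν : m - LUCDual.measureFunctional ν = 0 := by
      refine LUCDual.eq_zero_of_phi_mem_normalOperators μ ?_ fun f hf => ?_
      · refine WeakDual.continuous_of_continuous_eval fun g => ?_
        exact ((WeakDual.eval_continuous g).comp hm).sub
          ((WeakDual.eval_continuous g).comp (LUCDual.phi_measureFunctional_mem μ ν))
      · rw [_root_.sub_apply, hν f hf, LUCDual.measureFunctional_apply, sub_self]
    refine ⟨m, ⟨ν, inferInstance, inferInstance, fun f => ?_⟩, rfl⟩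
    exact sub_eq_zero.1 (ContinuousLinearMap.ext_iff.1 hmν f)
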